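/- Let $m\ge 2$, $1\le \ell<m$, and let $\Omega_i\subset\mathbb R^{n_i}$ ($n_i\ge 1$, $i=1,\dots,m$) be bounded open sets. Suppose that each $L^2(\Omega_i)$ carries a multiscale hierarchy of exactness $r_i\in\mathbb N_0$, that is, a nested sequence of finite dimensional subspaces $V^{(i)}_0\subset V^{(i)}_1\subset\cdots\subset L^2(\Omega_i)$ with dense union, with $c\,2^{jn_i}\le\dim V^{(i)}_j\le C\,2^{jn_i}$ for some constants $c,C>0$ and all $j\ge 0$, and such that for every $0\le t\le r_i$ there is a constant $C_t$ with $$\inf_{v\in V^{(i)}_j}\|u-v\|_{L^2(\Omega_i)}\le C_t\,2^{-jt}\|u\|_{H^t(\Omega_i)}\qquad\text{for all } j\ge 0,\ u\in H^t(\Omega_i).$$ Here $H^t(\Omega_i)$, $t\ge0$, is the Sobolev(–Slobodeckij) space of real-valued functions with its usual Hilbert norm. Let $s=(s_1,\dots,s_m)$ be real numbers with $0\le s_i\le r_i$, let $\mathbf\Omega=\Omega_1\times\cdots\times\Omega_m$, and let $$\mathbf H^{s}(\mathbf\Omega)=H^{s_1}(\Omega_1)\otimes\cdots\otimes H^{s_m}(\Omega_m)\subset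 L^2(\mathbf\Omega)$$ be the Hilbert space tensor product with its cross norm. Put $$\beta=\min_{i\le\ell}\frac{s_i}{n_i}+\min_{i>\ell}\frac{s_i}{n_i},$$ and let $P_1$ and $P_2$ be the number of indices $i\le\ell$, respectively $i>\ell$, at which the first, respectively the second, minimum is attained. Then there is a constant $C>0$ (which may depend on $m$, $\ell$, the $s_i$, $n_i$, $\Omega_i$ and the hierarchies, but not on $f$ or $R$) such that for every $f\in\mathbf H^{s}(\mathbf\Omega)$ and every integer $R\ge 2$ there are functions $g^{(1)}_1,\dots,g^{(1)}_R\in L^2(\Omega_1\times\cdots\times\Omega_\ell)$ and $g^{(2)}_1,\dots,g^{(2)}_R\in L^2(\Omega_{\ell+1}\times\cdots\times\Omega_m)$ for which $$f_R(x_1,\dots,x_m)=\sum_{\rho=1}^R g^{(1)}_\rho(x_1,\dots,x_\ell)\,g^{(2)}_\rho(x_{\ell+1},\dots,x_m)$$ lies in $L^2(\mathbf\Omega)$ and satisfies $$\|f-f_R\|_{L^2(\mathbf\Omega)}\le C\,R^{-\beta}(\log R)^{\frac{m-1}{2}+\beta\,(\max\{P_1,P_2\}-1)}\,\|f\|_{\mathbf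 H^{s}(\mathbf\Omega)}.$$ -/

import Mathlib

open MeasureTheory Filter Topology
open scoped ContDiff

noncomputable section

/-! ### Sobolev spaces `H^s(Ω)` of real order `s ≥ 0` on an open set `Ω ⊆ ℝⁿ` -/

/-- The Hilbert space `L²(Ω)`. -/
abbrev L2 {n : ℕ} (Ω : Set (EuclideanSpace ℝ (Fin n))) :=
  Lp ℝ 2 (volume.restrict Ω)

/-- The classical partial derivative `∂_i φ`. -/
def partialDeriv {n : ℕ} (i : Fin n) (φ : EuclideanSpace ℝ (Fin n) → ℝ) :
    EuclideanSpace ℝ (Fin n) → ℝ :=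
  fun x => fderiv ℝ φ x (EuclideanSpace.single i 1)

/-- The classical derivative `∂^α φ = ∂_1^{α_1} ⋯ ∂_n^{α_n} φ` for a multi-index `α`. -/
def multiDeriv {n : ℕ} (α : Fin n → ℕ) (φ : EuclideanSpace ℝ (Fin n) → ℝ) :
    EuclideanSpace ℝ (Fin n) → ℝ :=
  (List.finRange n).foldr (fun i ψ => (partialDeriv i)^[α i] ψ) φ

/-- `v` is the weak derivative `D^α u` of `u` on `Ω`:
`∫_Ω u ∂^α φ = (-1)^{|α|} ∫_Ω v φ` for all `φ ∈ C_c^∞(Ω)`. -/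
def IsWeakDeriv {n : ℕ} (Ω : Set (EuclideanSpace ℝ (Fin n))) (α : Fin n → ℕ)
    (u v : L2 Ω) : Prop :=
  ∀ φ : EuclideanSpace ℝ (Fin n) → ℝ,
    ContDiff ℝ ∞ φ → HasCompactSupport φ → tsupport φ ⊆ Ω →
      ∫ x in Ω, u x * multiDeriv α φ x = (-1) ^ (∑ i, α i) * ∫ x in Ω, v x * φ x

open Classical in
/-- The weak derivative `D^α u ∈ L²(Ω)` (it is unique if it exists; `0` if there is none). -/
def weakDeriv {n : ℕ} (Ω : Set (EuclideanSpace ℝ (Fin n))) (α : Fin n → ℕ) (u : L2 Ω) : L2 Ω :=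
  if h : ∃ v : L2 Ω, IsWeakDeriv Ω α u v then h.choose else 0

/-- The integrand of the Slobodeckij form of order `0 < σ < 1`,
`(u(x) - u(y)) (v(x) - v(y)) / |x - y|^{n + 2σ}`. -/
def slobodeckijIntegrand {n : ℕ} (σ : ℝ) (u v : EuclideanSpace ℝ (Fin n) → ℝ)
    (p : EuclideanSpace ℝ (Fin n) × EuclideanSpace ℝ (Fin n)) : ℝ :=
  (u p.1 - u p.2) * (v p.1 - v p.2) / ‖p.1 - p.2‖ ^ ((n : ℝ) + 2 * σ)

/-- `u ∈ H^s(Ω)` for `s = k + σ`, `k ∈ ℕ`, `0 ≤ σ < 1`: all weak derivatives of order at most `k`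
lie in `L²(Ω)` and, if `σ > 0`, those of order `k` have a finite Slobodeckij seminorm. -/
def MemSobolev {n : ℕ} (Ω : Set (EuclideanSpace ℝ (Fin n))) (s : ℝ) (u : L2 Ω) : Prop :=
  (∀ α : Fin n → ℕ, ∑ i, α i ≤ ⌊s⌋₊ → ∃ v : L2 Ω, IsWeakDeriv Ω α u v) ∧
  (0 < Int.fract s → ∀ α : Fin n → ℕ, ∑ i, α i = ⌊s⌋₊ →
    Integrable (slobodeckijIntegrand (Int.fract s) (weakDeriv Ω α u) (weakDeriv Ω α u))
      ((volume.restrict Ω).prod (volume.restrict Ω)))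

/-- The inner product of `H^s(Ω)`, `s = k + σ`:
`∑_{|α| ≤ k} (D^α u, D^α v)_{L²(Ω)}`, plus, if `σ > 0`, the Slobodeckij forms of order `σ` of the
derivatives of order `k`. -/
def sobolevInner {n : ℕ} (Ω : Set (EuclideanSpace ℝ (Fin n))) (s : ℝ) (u v : L2 Ω) : ℝ :=
  (∑ j ∈ Finset.range (⌊s⌋₊ + 1), ∑ α ∈ Finset.piAntidiag (Finset.univ : Finset (Fin n)) j,
    inner ℝ (weakDeriv Ω α u) (weakDeriv Ω α v)) +
  if 0 < Int.fract s then
    ∑ α ∈ Finset.piAntidiag (Finset.univ : Finset (Fin n)) ⌊s⌋₊,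
      ∫ p, slobodeckijIntegrand (Int.fract s) (weakDeriv Ω α u) (weakDeriv Ω α v) p
        ∂((volume.restrict Ω).prod (volume.restrict Ω))
  else 0

/-- The norm of `H^s(Ω)`. -/
def sobolevNorm {n : ℕ} (Ω : Set (EuclideanSpace ℝ (Fin n))) (s : ℝ) (u : L2 Ω) : ℝ :=
  Real.sqrt (sobolevInner Ω s u u)

/-- The space `H^s(Ω)`. -/
abbrev SobolevSpace {n : ℕ} (Ω : Set (EuclideanSpace ℝ (Fin n))) (s : ℝ) :=
  {u : L2 Ω // MemSobolev Ω s u}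

/-! ### Multiscale hierarchies -/

/-- A multiscale hierarchy `V_0 ⊆ V_1 ⊆ ⋯ ⊆ L²(Ω)` of exactness `r`: finite dimensional nested
spaces with `dim V_j ∼ 2^{jn}`, dense union, and the approximation property
`inf_{v ∈ V_j} ‖u - v‖_{L²(Ω)} ≲ 2^{-jt} ‖u‖_{H^t(Ω)}` for `0 ≤ t ≤ r`, uniformly in `j`. -/
structure IsMultiscaleHierarchy {n : ℕ} (Ω : Set (EuclideanSpace ℝ (Fin n))) (r : ℕ)
    (V : ℕ → Submodule ℝ (L2 Ω)) : Prop where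
  nested : Monotone V
  finiteDimensional : ∀ j, FiniteDimensional ℝ (V j)
  dim_equiv : ∃ c > (0 : ℝ), ∃ C > (0 : ℝ), ∀ j : ℕ,
    c * 2 ^ (j * n) ≤ Module.finrank ℝ (V j) ∧ (Module.finrank ℝ (V j) : ℝ) ≤ C * 2 ^ (j * n)
  dense : Dense (⋃ j, (V j : Set (L2 Ω)))
  approx : ∀ t : ℝ, 0 ≤ t → t ≤ r → ∃ C : ℝ, ∀ (j : ℕ) (u : L2 Ω), MemSobolev Ω t u →
    Metric.infDist u (V j : Set (L2 Ω)) ≤ C * (2 : ℝ) ^ (-((j : ℝ) * t)) * sobolevNorm Ω t u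

/-! ### The mixed Sobolev space `H^{s_1}(Ω_1) ⊗ ⋯ ⊗ H^{s_m}(Ω_m)` -/

section Mixed

variable {m : ℕ} {n : Fin m → ℕ}

/-- The measure of the product domain `Ω_1 × ⋯ × Ω_m`. -/
def prodMeasure (Ω : ∀ i, Set (EuclideanSpace ℝ (Fin (n i)))) :
    Measure (∀ i, EuclideanSpace ℝ (Fin (n i))) :=
  Measure.pi fun i => volume.restrict (Ω i)

/-- Finite linear combinations `∑_a c_a u_{a,1} ⊗ ⋯ ⊗ u_{a,m}` of elementary tensors with
`u_{a,i} ∈ H^{s_i}(Ω_i)`: representatives of the elements of the algebraic tensor product. -/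
abbrev AlgTensor (Ω : ∀ i, Set (EuclideanSpace ℝ (Fin (n i)))) (s : Fin m → ℝ) :=
  (∀ i, SobolevSpace (Ω i) (s i)) →₀ ℝ

/-- The function `x ↦ ∑_a c_a u_{a,1}(x_1) ⋯ u_{a,m}(x_m)`. -/
def AlgTensor.toFun {Ω : ∀ i, Set (EuclideanSpace ℝ (Fin (n i)))} {s : Fin m → ℝ}
    (t : AlgTensor Ω s) (x : ∀ i, EuclideanSpace ℝ (Fin (n i))) : ℝ :=
  t.sum fun u c => c * ∏ i, (u i).1 (x i)

/-- The cross norm, induced by the inner product with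
`⟨⊗ u_i, ⊗ v_i⟩ = ∏ ⟨u_i, v_i⟩_{H^{s_i}(Ω_i)}`. -/
def AlgTensor.crossNorm {Ω : ∀ i, Set (EuclideanSpace ℝ (Fin (n i)))} {s : Fin m → ℝ}
    (t : AlgTensor Ω s) : ℝ :=
  Real.sqrt (t.sum fun u c => t.sum fun v d =>
    c * d * ∏ i, sobolevInner (Ω i) (s i) (u i).1 (v i).1)

/-- `f` is the element of norm `N` of the completion of the algebraic tensor product with respect
to the cross norm which is represented by some cross-norm Cauchy sequence `t`: the cross norms of
`t` tend to `N`, and `t` tends to `f` in `L²(Ω_1 × ⋯ × Ω_m)`. -/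
def HasMixedNorm (Ω : ∀ i, Set (EuclideanSpace ℝ (Fin (n i)))) (s : Fin m → ℝ)
    (f : (∀ i, EuclideanSpace ℝ (Fin (n i))) → ℝ) (N : ℝ) : Prop :=
  ∃ t : ℕ → AlgTensor Ω s,
    (∀ ε > 0, ∃ K, ∀ k ≥ K, ∀ l ≥ K, AlgTensor.crossNorm (t k - t l) < ε) ∧
    Tendsto (fun k => (t k).crossNorm) atTop (𝓝 N) ∧
    Tendsto (fun k => eLpNorm (fun x => f x - (t k).toFun x) 2 (prodMeasure Ω)) atTop (𝓝 0)

/-- `f ∈ H^{s_1}(Ω_1) ⊗ ⋯ ⊗ H^{s_m}(Ω_m)`, the Hilbert space tensor product, regarded as a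
space of functions in `L²(Ω_1 × ⋯ × Ω_m)`. -/
def MemMixedSobolev (Ω : ∀ i, Set (EuclideanSpace ℝ (Fin (n i)))) (s : Fin m → ℝ)
    (f : (∀ i, EuclideanSpace ℝ (Fin (n i))) → ℝ) : Prop :=
  MemLp f 2 (prodMeasure Ω) ∧ ∃ N, HasMixedNorm Ω s f N

/-- The norm of `H^{s_1}(Ω_1) ⊗ ⋯ ⊗ H^{s_m}(Ω_m)`. The completion embeds into `L²`, so for a
member `f` of the space the set below consists of exactly one number. -/
def mixedSobolevNorm (Ω : ∀ i, Set (EuclideanSpace ℝ (Fin (n i)))) (s : Fin m → ℝ)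
    (f : (∀ i, EuclideanSpace ℝ (Fin (n i))) → ℝ) : ℝ :=
  sInf {N | HasMixedNorm Ω s f N}

end Mixed

/-! ### The split of the variables and the rate -/

/-- The first `ℓ` of the indices of `m` variables. -/
abbrev FirstIdx (m ℓ : ℕ) := {i : Fin m // (i : ℕ) < ℓ}

/-- The remaining `m - ℓ` indices. -/
abbrev LastIdx (m ℓ : ℕ) := {i : Fin m // ℓ ≤ (i : ℕ)}

/-- The function
`∑_{ρ=1}^{R} g_ρ^{(1)}(x_1, …, x_ℓ) g_ρ^{(2)}(x_{ℓ+1}, …, x_m)`. -/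
def separableSum {m : ℕ} {n : Fin m → ℕ} {ℓ R : ℕ}
    (g₁ : Fin R → (∀ i : FirstIdx m ℓ, EuclideanSpace ℝ (Fin (n i))) → ℝ)
    (g₂ : Fin R → (∀ i : LastIdx m ℓ, EuclideanSpace ℝ (Fin (n i))) → ℝ)
    (x : ∀ i, EuclideanSpace ℝ (Fin (n i))) : ℝ :=
  ∑ ρ, g₁ ρ (fun i => x i) * g₂ ρ (fun i => x i)

/-- How often the minimum of the finite family `q` is attained. -/
def minCount {ι : Type} (q : ι → ℝ) : ℕ :=
  Nat.card {i : ι // q i = ⨅ j, q j}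

end

/-! ### Linearity of weak derivatives -/

/-! Orthogonal projections onto the nested spaces split each `L²(Ω_i)` into orthogonal levels. Level
`j` lies in a space of dimension `O(2^{j n_i})`, and the level-`j` component of `u ∈ H^{s_i}` has
norm `O(2^{-j s_i})`. The levels are cut off at some `J_i`: one last level collects everything
beyond and obeys the same decay bound, so only finite sums occur
(`IsMultiscaleHierarchy.exists_levels`). Tensorising, `f` becomes an orthogonal sum of blocks `f_a`
over multi-indices `a`, with `‖f_a‖² ≲ ∏ 4^{-s_i a_i} ‖f‖²`.

Take finite sets `A₁`, `A₂` of multi-indices for the two groups of variables. Blocks whose first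
half is a fixed `α ∈ A₁` have all their left factors in one space of dimension at most `∏ dim
V_{α_i}`, so together they have at most that rank, whatever their second half is; the same holds for
`A₂`. Every block with at least one half in its set is kept, and the two ranks add. A discarded
block has both halves outside, so the squared error is at most a product of two tail sums
(`sum_prod_le_mul_sum_prod`). This is why the two minima add up in `β` although each group may use
only `R/2` terms.

For one group of `k` variables with minimum `b > 0` attained `P` times, the set is a simplex `∑ s_i
a_i log 4 ≤ K` (`exists_index_set`). Its dimension count is `O(e^{K/(2b)} (1+K)^{P-1})`
(`sum_exp_head_le`), and its tail is `O(e^{-K} (1+K)^{k-1})` (`sum_exp_tail_le`). Taking `e^K` of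
order `(R / (log R)^{P-1})^{2b}` makes the tail `O(R^{-2b} (log R)^{k-1+2b(P-1)})`. Multiplying both
tails and taking the root gives the rate, even with `(m-2)/2` in place of `(m-1)/2`.

The block bound says that a tensor product of operators is bounded by the product of the individual
bounds. It is proved for algebraic tensors by comparing Gram matrices with the Schur product theorem
(`norm_sq_tensorImage_le`). A general `f` is then replaced by a nearby algebraic tensor of
comparable norm. -/

theorem partialDeriv_contDiff {n : ℕ} (i : Fin n) {φ : EuclideanSpace ℝ (Fin n) → ℝ}
    (h : ContDiff ℝ ∞ φ) : ContDiff ℝ ∞ (partialDeriv i φ) :=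
  (h.fderiv_right (m := ∞) (by simp)).clm_apply contDiff_const

theorem partialDeriv_hasCompactSupport {n : ℕ} (i : Fin n) {φ : EuclideanSpace ℝ (Fin n) → ℝ}
    (h : HasCompactSupport φ) : HasCompactSupport (partialDeriv i φ) :=
  h.fderiv_apply (𝕜 := ℝ) _

theorem multiDeriv_contDiff_and_hasCompactSupport {n : ℕ} (α : Fin n → ℕ)
    {φ : EuclideanSpace ℝ (Fin n) → ℝ} (h : ContDiff ℝ ∞ φ) (hc : HasCompactSupport φ) :
    ContDiff ℝ ∞ (multiDeriv α φ) ∧ HasCompactSupport (multiDeriv α φ) := by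
  have key : ∀ (l : List (Fin n)) (ψ : EuclideanSpace ℝ (Fin n) → ℝ),
      ContDiff ℝ ∞ ψ ∧ HasCompactSupport ψ →
      ContDiff ℝ ∞ (l.foldr (fun i ψ => (partialDeriv i)^[α i] ψ) ψ) ∧
        HasCompactSupport (l.foldr (fun i ψ => (partialDeriv i)^[α i] ψ) ψ) := by
    intro l ψ hψ
    induction l with
    | nil => exact hψ
    | cons i l ih =>
      simp only [List.foldr_cons]
      induction α i with
      | zero => exact ih
      | succ k hk =>
        rw [Function.iterate_succ_apply']
        exact ⟨partialDeriv_contDiff i hk.1, partialDeriv_hasCompactSupport i hk.2⟩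
  exact key _ _ ⟨h, hc⟩

theorem multiDeriv_zero {n : ℕ} (φ : EuclideanSpace ℝ (Fin n) → ℝ) :
    multiDeriv (0 : Fin n → ℕ) φ = φ := by
  unfold multiDeriv
  induction List.finRange n with
  | nil => rfl
  | cons i l ih => simp

theorem integrable_L2_mul_testFunction {n : ℕ} {Ω : Set (EuclideanSpace ℝ (Fin n))} (u : L2 Ω)
    {φ : EuclideanSpace ℝ (Fin n) → ℝ} (h : ContDiff ℝ ∞ φ) (hc : HasCompactSupport φ) :
    Integrable (fun x => u x * φ x) (volume.restrict Ω) :=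
  (Lp.memLp u).integrable_mul (q := 2) ((h.continuous.memLp_of_hasCompactSupport hc).restrict Ω)

/-- The fundamental lemma of the calculus of variations. Since `weakDeriv` is made by choice, its
linearity, and hence the bilinearity of the Sobolev inner product, rests on this. -/
theorem IsWeakDeriv.unique {n : ℕ} {Ω : Set (EuclideanSpace ℝ (Fin n))} (hΩ : IsOpen Ω)
    {α : Fin n → ℕ} {u v w : L2 Ω} (hv : IsWeakDeriv Ω α u v) (hw : IsWeakDeriv Ω α u w) :
    v = w := by
  have hloc : LocallyIntegrableOn (fun x => v x - w x) Ω volume := by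
    apply locallyIntegrableOn_of_locallyIntegrable_restrict
    exact (((Lp.memLp v).locallyIntegrable (by norm_num)).sub
      ((Lp.memLp w).locallyIntegrable (by norm_num)))
  have h0 := hΩ.ae_eq_zero_of_integral_contDiff_smul_eq_zero hloc (fun φ h hc hs => by
    have e := (hv φ h hc hs).symm.trans (hw φ h hc hs)
    have e' := mul_left_cancel₀ (pow_ne_zero _ (by norm_num)) e
    have : ∫ x in Ω, φ x • (v x - w x) = 0 := by
      rw [← sub_eq_zero, ← integral_sub (integrable_L2_mul_testFunction v h hc)
        (integrable_L2_mul_testFunction w h hc)] at e'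
      rw [← e']
      congr 1; ext x; simp only [smul_eq_mul]; ring
    rw [← this]
    symm
    apply setIntegral_eq_integral_of_forall_compl_eq_zero
    intro x hx
    rw [image_eq_zero_of_notMem_tsupport (fun h => hx (hs h)), zero_smul])
  apply Lp.ext
  rw [← ae_restrict_iff' hΩ.measurableSet] at h0
  filter_upwards [h0] with x hx
  linarith

theorem IsWeakDeriv.add {n : ℕ} {Ω : Set (EuclideanSpace ℝ (Fin n))} {α : Fin n → ℕ}
    {u v u' v' : L2 Ω} (h : IsWeakDeriv Ω α u v) (h' : IsWeakDeriv Ω α u' v') :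
    IsWeakDeriv Ω α (u + u') (v + v') := by
  intro φ hφ hc hs
  obtain ⟨hd, hdc⟩ := multiDeriv_contDiff_and_hasCompactSupport α hφ hc
  have e : ∀ (a b : L2 Ω) (ψ : EuclideanSpace ℝ (Fin n) → ℝ), ContDiff ℝ ∞ ψ →
      HasCompactSupport ψ → ∫ x in Ω, (a + b : L2 Ω) x * ψ x =
        (∫ x in Ω, a x * ψ x) + ∫ x in Ω, b x * ψ x := by
    intro a b ψ h1 h2
    rw [← integral_add (integrable_L2_mul_testFunction a h1 h2)
      (integrable_L2_mul_testFunction b h1 h2)]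
    apply integral_congr_ae
    filter_upwards [Lp.coeFn_add a b] with x hx
    rw [hx, Pi.add_apply, add_mul]
  rw [e _ _ _ hd hdc, e _ _ _ hφ hc, h φ hφ hc hs, h' φ hφ hc hs, mul_add]

theorem IsWeakDeriv.smul {n : ℕ} {Ω : Set (EuclideanSpace ℝ (Fin n))} {α : Fin n → ℕ}
    {u v : L2 Ω} (c : ℝ) (h : IsWeakDeriv Ω α u v) : IsWeakDeriv Ω α (c • u) (c • v) := by
  intro φ hφ hc hs
  have e : ∀ (a : L2 Ω) (ψ : EuclideanSpace ℝ (Fin n) → ℝ),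
      ∫ x in Ω, (c • a : L2 Ω) x * ψ x = c * ∫ x in Ω, a x * ψ x := by
    intro a ψ
    rw [← integral_const_mul]
    apply integral_congr_ae
    filter_upwards [Lp.coeFn_smul c a] with x hx
    rw [hx, Pi.smul_apply, smul_eq_mul, mul_assoc]
  rw [e, e, h φ hφ hc hs]
  ring

theorem isWeakDeriv_zero_index {n : ℕ} {Ω : Set (EuclideanSpace ℝ (Fin n))} (u : L2 Ω) :
    IsWeakDeriv Ω 0 u u := by
  intro φ _ _ _
  simp [multiDeriv_zero]

theorem weakDeriv_spec {n : ℕ} {Ω : Set (EuclideanSpace ℝ (Fin n))} {α : Fin n → ℕ} {u : L2 Ω}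
    (h : ∃ v : L2 Ω, IsWeakDeriv Ω α u v) : IsWeakDeriv Ω α u (weakDeriv Ω α u) := by
  rw [weakDeriv, dif_pos h]
  exact h.choose_spec

theorem IsWeakDeriv.weakDeriv_eq {n : ℕ} {Ω : Set (EuclideanSpace ℝ (Fin n))} (hΩ : IsOpen Ω)
    {α : Fin n → ℕ} {u v : L2 Ω} (h : IsWeakDeriv Ω α u v) : weakDeriv Ω α u = v :=
  (weakDeriv_spec ⟨v, h⟩).unique hΩ h

/-! ### The Slobodeckij form -/

theorem slobodeckijIntegrand_aestronglyMeasurable {n : ℕ} {Ω : Set (EuclideanSpace ℝ (Fin n))}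
    (σ : ℝ) (u v : L2 Ω) : AEStronglyMeasurable (slobodeckijIntegrand σ u v)
      ((volume.restrict Ω).prod (volume.restrict Ω)) := by
  have hu := Lp.aestronglyMeasurable u
  have hv := Lp.aestronglyMeasurable v
  have hk : Measurable fun p : EuclideanSpace ℝ (Fin n) × EuclideanSpace ℝ (Fin n) =>
      ‖p.1 - p.2‖ ^ ((n : ℝ) + 2 * σ) := by fun_prop
  exact (((hu.comp_fst.sub hu.comp_snd).mul (hv.comp_fst.sub hv.comp_snd)).aemeasurable.div
    hk.aemeasurable).aestronglyMeasurable

theorem slobodeckijIntegrand_self_nonneg {n : ℕ} (σ : ℝ) (u : EuclideanSpace ℝ (Fin n) → ℝ)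
    (p : EuclideanSpace ℝ (Fin n) × EuclideanSpace ℝ (Fin n)) :
    0 ≤ slobodeckijIntegrand σ u u p :=
  div_nonneg (mul_self_nonneg _) (Real.rpow_nonneg (norm_nonneg _) _)

theorem slobodeckijIntegrand_comm {n : ℕ} (σ : ℝ) (u v : EuclideanSpace ℝ (Fin n) → ℝ) :
    slobodeckijIntegrand σ u v = slobodeckijIntegrand σ v u := by
  ext p; simp only [slobodeckijIntegrand, mul_comm]

/-- Pointwise `|ab| ≤ a² + b²` for the two difference quotients. -/
theorem slobodeckijIntegrand_integrable {n : ℕ} {Ω : Set (EuclideanSpace ℝ (Fin n))} {σ : ℝ}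
    {u v : L2 Ω}
    (hu : Integrable (slobodeckijIntegrand σ u u) ((volume.restrict Ω).prod (volume.restrict Ω)))
    (hv : Integrable (slobodeckijIntegrand σ v v) ((volume.restrict Ω).prod (volume.restrict Ω))) :
    Integrable (slobodeckijIntegrand σ u v) ((volume.restrict Ω).prod (volume.restrict Ω)) := by
  refine (hu.add hv).mono' (slobodeckijIntegrand_aestronglyMeasurable σ u v) ?_
  refine Eventually.of_forall fun p => ?_
  have h0 : 0 ≤ ‖p.1 - p.2‖ ^ ((n : ℝ) + 2 * σ) := Real.rpow_nonneg (norm_nonneg _) _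
  rw [Pi.add_apply, slobodeckijIntegrand, slobodeckijIntegrand, slobodeckijIntegrand,
    Real.norm_eq_abs, abs_div, abs_of_nonneg h0, ← add_div]
  gcongr
  rw [abs_le]
  constructor <;> nlinarith [sq_nonneg ((u p.1 - u p.2) + (v p.1 - v p.2)),
    sq_nonneg ((u p.1 - u p.2) - (v p.1 - v p.2)), mul_self_nonneg (u p.1 - u p.2),
    mul_self_nonneg (v p.1 - v p.2)]

theorem slobodeckijIntegrand_linear_left {n : ℕ} {Ω : Set (EuclideanSpace ℝ (Fin n))} (σ c : ℝ)
    (u u' : L2 Ω) (v : EuclideanSpace ℝ (Fin n) → ℝ) :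
    slobodeckijIntegrand σ (c • u + u' : L2 Ω) v
      =ᵐ[(volume.restrict Ω).prod (volume.restrict Ω)]
    fun p => c * slobodeckijIntegrand σ u v p + slobodeckijIntegrand σ u' v p := by
  have h : ⇑(c • u + u' : L2 Ω) =ᵐ[volume.restrict Ω] fun x => c * u x + u' x := by
    filter_upwards [Lp.coeFn_add (c • u) u', Lp.coeFn_smul c u] with x h1 h2
    rw [h1, Pi.add_apply, h2, Pi.smul_apply, smul_eq_mul]
  filter_upwards [Measure.quasiMeasurePreserving_fst.ae_eq_comp h,
    Measure.quasiMeasurePreserving_snd.ae_eq_comp h] with p h1 h2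
  simp only [Function.comp_apply] at h1 h2
  simp only [slobodeckijIntegrand, h1, h2]
  ring

/-! ### `H^s(Ω)` as a subspace carrying a bilinear form -/

theorem weakDeriv_linear {n : ℕ} {Ω : Set (EuclideanSpace ℝ (Fin n))} (hΩ : IsOpen Ω)
    {α : Fin n → ℕ} {u v : L2 Ω} (c : ℝ) (hu : ∃ w : L2 Ω, IsWeakDeriv Ω α u w)
    (hv : ∃ w : L2 Ω, IsWeakDeriv Ω α v w) :
    weakDeriv Ω α (c • u + v) = c • weakDeriv Ω α u + weakDeriv Ω α v :=
  (((weakDeriv_spec hu).smul c).add (weakDeriv_spec hv)).weakDeriv_eq hΩ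

theorem slobodeckijIntegrand_integrable_linear {n : ℕ} {Ω : Set (EuclideanSpace ℝ (Fin n))}
    {σ : ℝ} (c : ℝ) {u v : L2 Ω}
    (hu : Integrable (slobodeckijIntegrand σ u u) ((volume.restrict Ω).prod (volume.restrict Ω)))
    (hv : Integrable (slobodeckijIntegrand σ v v) ((volume.restrict Ω).prod (volume.restrict Ω))) :
    Integrable (slobodeckijIntegrand σ (c • u + v : L2 Ω) (c • u + v : L2 Ω))
      ((volume.restrict Ω).prod (volume.restrict Ω)) := by
  have huv := slobodeckijIntegrand_integrable hu hv
  have h1 : Integrable (slobodeckijIntegrand σ (c • u + v : L2 Ω) u)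
      ((volume.restrict Ω).prod (volume.restrict Ω)) := by
    refine ((hu.const_mul c).add ?_).congr (slobodeckijIntegrand_linear_left σ c u v u).symm
    rwa [slobodeckijIntegrand_comm]
  have h2 : Integrable (slobodeckijIntegrand σ (c • u + v : L2 Ω) v)
      ((volume.restrict Ω).prod (volume.restrict Ω)) :=
    ((huv.const_mul c).add hv).congr (slobodeckijIntegrand_linear_left σ c u v v).symm
  refine ((h1.const_mul c).add h2).congr ?_
  rw [slobodeckijIntegrand_comm σ _ u, slobodeckijIntegrand_comm σ _ v]
  exact (slobodeckijIntegrand_linear_left σ c u v _).symm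

theorem MemSobolev.linear {n : ℕ} {Ω : Set (EuclideanSpace ℝ (Fin n))} (hΩ : IsOpen Ω)
    {s : ℝ} {u v : L2 Ω} (c : ℝ) (hu : MemSobolev Ω s u) (hv : MemSobolev Ω s v) :
    MemSobolev Ω s (c • u + v) := by
  refine ⟨fun α hα => ⟨_, ((weakDeriv_spec (hu.1 α hα)).smul c).add (weakDeriv_spec (hv.1 α hα))⟩,
    fun hσ α hα => ?_⟩
  rw [weakDeriv_linear hΩ c (hu.1 α hα.le) (hv.1 α hα.le)]
  exact slobodeckijIntegrand_integrable_linear c (hu.2 hσ α hα) (hv.2 hσ α hα)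

theorem isWeakDeriv_zero {n : ℕ} {Ω : Set (EuclideanSpace ℝ (Fin n))} (α : Fin n → ℕ) :
    IsWeakDeriv Ω α 0 0 := by
  have e : ∀ ψ : EuclideanSpace ℝ (Fin n) → ℝ, ∫ x in Ω, (0 : L2 Ω) x * ψ x = 0 := by
    intro ψ
    rw [integral_eq_zero_of_ae]
    filter_upwards [Lp.coeFn_zero ℝ 2 (volume.restrict Ω)] with x hx
    rw [hx]; simp
  intro φ _ _ _
  rw [e, e, mul_zero]

theorem MemSobolev.zero {n : ℕ} {Ω : Set (EuclideanSpace ℝ (Fin n))} (hΩ : IsOpen Ω) (s : ℝ) :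
    MemSobolev Ω s 0 := by
  refine ⟨fun α _ => ⟨0, isWeakDeriv_zero α⟩, fun _ α _ => ?_⟩
  rw [(isWeakDeriv_zero α).weakDeriv_eq hΩ]
  refine (integrable_zero _ _ _).congr ?_
  have h := Lp.coeFn_zero ℝ 2 (volume.restrict Ω)
  filter_upwards [Measure.quasiMeasurePreserving_fst.ae_eq_comp h,
    Measure.quasiMeasurePreserving_snd.ae_eq_comp h] with p h1 h2
  simp only [Function.comp_apply] at h1 h2
  rw [slobodeckijIntegrand, h1, h2]
  simp

/-- `H^s(Ω)` as a subspace of `L²(Ω)`. -/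
def sobolevSubmodule {n : ℕ} (Ω : Set (EuclideanSpace ℝ (Fin n))) (hΩ : IsOpen Ω) (s : ℝ) :
    Submodule ℝ (L2 Ω) where
  carrier := {u | MemSobolev Ω s u}
  zero_mem' := MemSobolev.zero hΩ s
  add_mem' {u v} hu hv := by simpa using MemSobolev.linear hΩ 1 hu hv
  smul_mem' c u hu := by simpa using MemSobolev.linear hΩ c hu (MemSobolev.zero hΩ s)

theorem sobolevInner_comm {n : ℕ} (Ω : Set (EuclideanSpace ℝ (Fin n))) (s : ℝ) (u v : L2 Ω) :
    sobolevInner Ω s u v = sobolevInner Ω s v u := by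
  simp only [sobolevInner, slobodeckijIntegrand_comm _ (weakDeriv Ω _ u), real_inner_comm]

theorem sobolevInner_linear_left {n : ℕ} {Ω : Set (EuclideanSpace ℝ (Fin n))} (hΩ : IsOpen Ω)
    {s : ℝ} (c : ℝ) {u v w : L2 Ω} (hu : MemSobolev Ω s u) (hv : MemSobolev Ω s v)
    (hw : MemSobolev Ω s w) :
    sobolevInner Ω s (c • u + v) w = c * sobolevInner Ω s u w + sobolevInner Ω s v w := by
  have h1 : ∑ j ∈ Finset.range (⌊s⌋₊ + 1),
      ∑ α ∈ Finset.piAntidiag (Finset.univ : Finset (Fin n)) j,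
        inner ℝ (weakDeriv Ω α (c • u + v)) (weakDeriv Ω α w) =
      c * (∑ j ∈ Finset.range (⌊s⌋₊ + 1),
        ∑ α ∈ Finset.piAntidiag (Finset.univ : Finset (Fin n)) j,
          inner ℝ (weakDeriv Ω α u) (weakDeriv Ω α w)) +
      ∑ j ∈ Finset.range (⌊s⌋₊ + 1),
        ∑ α ∈ Finset.piAntidiag (Finset.univ : Finset (Fin n)) j,
          inner ℝ (weakDeriv Ω α v) (weakDeriv Ω α w) := by
    simp only [Finset.mul_sum, ← Finset.sum_add_distrib]
    refine Finset.sum_congr rfl fun j hj => Finset.sum_congr rfl fun α hα => ?_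
    have hle : ∑ i, α i ≤ ⌊s⌋₊ := by
      rw [(Finset.mem_piAntidiag.1 hα).1]
      exact Nat.lt_succ_iff.1 (Finset.mem_range.1 hj)
    rw [weakDeriv_linear hΩ c (hu.1 α hle) (hv.1 α hle), inner_add_left, real_inner_smul_left]
  unfold sobolevInner
  rw [h1]
  split_ifs with hσ
  · have h2 : ∀ α ∈ Finset.piAntidiag (Finset.univ : Finset (Fin n)) ⌊s⌋₊,
        ∫ p, slobodeckijIntegrand (Int.fract s) (weakDeriv Ω α (c • u + v)) (weakDeriv Ω α w) p
          ∂((volume.restrict Ω).prod (volume.restrict Ω)) =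
        c * (∫ p, slobodeckijIntegrand (Int.fract s) (weakDeriv Ω α u) (weakDeriv Ω α w) p
          ∂((volume.restrict Ω).prod (volume.restrict Ω))) +
        ∫ p, slobodeckijIntegrand (Int.fract s) (weakDeriv Ω α v) (weakDeriv Ω α w) p
          ∂((volume.restrict Ω).prod (volume.restrict Ω)) := by
      intro α hα
      have hle : ∑ i, α i = ⌊s⌋₊ := (Finset.mem_piAntidiag.1 hα).1
      rw [weakDeriv_linear hΩ c (hu.1 α hle.le) (hv.1 α hle.le), ← integral_const_mul,
        ← integral_add ((slobodeckijIntegrand_integrable (hu.2 hσ α hle)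
          (hw.2 hσ α hle)).const_mul c) (slobodeckijIntegrand_integrable (hv.2 hσ α hle)
          (hw.2 hσ α hle))]
      exact integral_congr_ae (slobodeckijIntegrand_linear_left _ c _ _ _)
    rw [Finset.sum_congr rfl h2, Finset.sum_add_distrib, ← Finset.mul_sum]
    ring
  · ring

/-- The inner product of `H^s(Ω)` as a bilinear form. -/
noncomputable def sobolevForm {n : ℕ} (Ω : Set (EuclideanSpace ℝ (Fin n))) (hΩ : IsOpen Ω)
    (s : ℝ) : sobolevSubmodule Ω hΩ s →ₗ[ℝ] sobolevSubmodule Ω hΩ s →ₗ[ℝ] ℝ :=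
  have hadd : ∀ u v w : sobolevSubmodule Ω hΩ s, sobolevInner Ω s (u + v : L2 Ω) w =
      sobolevInner Ω s u w + sobolevInner Ω s v w := fun u v w => by
    simpa using sobolevInner_linear_left hΩ 1 u.2 v.2 w.2
  have hsmul : ∀ (c : ℝ) (u w : sobolevSubmodule Ω hΩ s), sobolevInner Ω s (c • u : L2 Ω) w =
      c * sobolevInner Ω s u w := fun c u w => by
    have h0 : sobolevInner Ω s (0 : L2 Ω) w = 0 := by
      simpa using hadd 0 0 w
    simpa [h0] using sobolevInner_linear_left hΩ c u.2 (MemSobolev.zero hΩ s) w.2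
  LinearMap.mk₂ ℝ (fun u v => sobolevInner Ω s u v)
    (fun u v w => hadd u v w) (fun c u w => hsmul c u w)
    (fun u v w => by
      rw [sobolevInner_comm Ω s u v, sobolevInner_comm Ω s u w, sobolevInner_comm]
      exact hadd v w u)
    (fun c u w => by
      rw [sobolevInner_comm Ω s u w, sobolevInner_comm]
      exact hsmul c w u)

/-- The term of the multi-index `0` is `‖u‖²`, and all others are nonnegative. -/
theorem norm_sq_le_sobolevInner {n : ℕ} {Ω : Set (EuclideanSpace ℝ (Fin n))} (hΩ : IsOpen Ω)
    (s : ℝ) (u : L2 Ω) : ‖u‖ ^ 2 ≤ sobolevInner Ω s u u := by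
  have h1 : ‖u‖ ^ 2 ≤ ∑ j ∈ Finset.range (⌊s⌋₊ + 1),
      ∑ α ∈ Finset.piAntidiag (Finset.univ : Finset (Fin n)) j,
        inner ℝ (weakDeriv Ω α u) (weakDeriv Ω α u) := by
    refine le_trans ?_ (Finset.single_le_sum (f := fun j =>
      ∑ α ∈ Finset.piAntidiag (Finset.univ : Finset (Fin n)) j,
        inner ℝ (weakDeriv Ω α u) (weakDeriv Ω α u))
      (fun j _ => Finset.sum_nonneg fun α _ => real_inner_self_nonneg)
      (Finset.mem_range.2 (Nat.succ_pos ⌊s⌋₊)))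
    refine le_trans ?_ (Finset.single_le_sum (f := fun α =>
        inner ℝ (weakDeriv Ω α u) (weakDeriv Ω α u))
      (fun α _ => real_inner_self_nonneg) (a := 0) (by simp))
    rw [(isWeakDeriv_zero_index u).weakDeriv_eq hΩ, real_inner_self_eq_norm_sq]
  refine h1.trans ?_
  rw [sobolevInner]
  refine le_add_of_nonneg_right ?_
  split_ifs
  · exact Finset.sum_nonneg fun α _ =>
      integral_nonneg fun p => slobodeckijIntegrand_self_nonneg _ _ _
  · exact le_rfl

/-! ### Elementary tensors in `L²` of a product measure -/

section PiTensor

variable {ι : Type*} [Fintype ι] {X : ι → Type*} [∀ i, MeasurableSpace (X i)]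
  (μ : ∀ i, Measure (X i)) [∀ i, SigmaFinite (μ i)]

theorem memLp_two_prod_eval {u : ∀ i, X i → ℝ} (hu : ∀ i, MemLp (u i) 2 (μ i)) :
    MemLp (fun x : ∀ i, X i => ∏ i, u i (x i)) 2 (Measure.pi μ) := by
  have hm : AEStronglyMeasurable (fun x : ∀ i, X i => ∏ i, u i (x i)) (Measure.pi μ) :=
    Finset.aestronglyMeasurable_fun_prod _ fun i _ =>
      (hu i).1.comp_quasiMeasurePreserving (Measure.quasiMeasurePreserving_eval μ i)
  rw [memLp_two_iff_integrable_sq hm]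
  simp only [← Finset.prod_pow]
  exact Integrable.fintype_prod_dep (f := fun i y => u i y ^ 2)
    fun i => (memLp_two_iff_integrable_sq (hu i).1).1 (hu i)

theorem prod_update_eval {ι : Type*} [Fintype ι] [DecidableEq ι] {X : ι → Type*}
    [∀ i, MeasurableSpace (X i)] {μ : ∀ i, Measure (X i)} (u : ∀ i, Lp ℝ 2 (μ i)) (i : ι)
    (a : Lp ℝ 2 (μ i)) (x : ∀ i, X i) : ∏ j, (Function.update u i a j) (x j) =
      a (x i) * ∏ j ∈ Finset.univ.erase i, u j (x j) := by
  rw [← Finset.mul_prod_erase _ _ (Finset.mem_univ i), Function.update_self]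
  congr 1
  refine Finset.prod_congr rfl fun j hj => ?_
  rw [Function.update_of_ne (Finset.ne_of_mem_erase hj)]

/-- The elementary tensor `u_1 ⊗ ⋯ ⊗ u_m`, as a multilinear map into `L²` of the product. -/
noncomputable def piTensor : MultilinearMap ℝ (fun i => Lp ℝ 2 (μ i)) (Lp ℝ 2 (Measure.pi μ)) where
  toFun u := (memLp_two_prod_eval μ fun i => Lp.memLp (u i)).toLp _
  map_update_add' u i a b := by
    apply Lp.ext
    refine (MemLp.coeFn_toLp _).trans ?_
    refine EventuallyEq.trans ?_ (Lp.coeFn_add _ _).symm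
    filter_upwards [MemLp.coeFn_toLp
        (memLp_two_prod_eval μ fun j => Lp.memLp (Function.update u i a j)),
      MemLp.coeFn_toLp (memLp_two_prod_eval μ fun j => Lp.memLp (Function.update u i b j)),
      (Measure.quasiMeasurePreserving_eval μ i).ae_eq_comp (Lp.coeFn_add a b)] with x h1 h2 h3
    simp only [Function.comp_apply, Function.eval, Pi.add_apply] at h3
    rw [Pi.add_apply, h1, h2, prod_update_eval, prod_update_eval, prod_update_eval, h3, add_mul]
  map_update_smul' u i c a := by
    apply Lp.ext
    refine (MemLp.coeFn_toLp _).trans ?_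
    refine EventuallyEq.trans ?_ (Lp.coeFn_smul _ _).symm
    filter_upwards [MemLp.coeFn_toLp
        (memLp_two_prod_eval μ fun j => Lp.memLp (Function.update u i a j)),
      (Measure.quasiMeasurePreserving_eval μ i).ae_eq_comp (Lp.coeFn_smul c a)] with x h1 h3
    simp only [Function.comp_apply, Function.eval, Pi.smul_apply, smul_eq_mul] at h3
    rw [Pi.smul_apply, h1, prod_update_eval, prod_update_eval, h3, smul_eq_mul, mul_assoc]

theorem coeFn_piTensor (u : ∀ i, Lp ℝ 2 (μ i)) :
    piTensor μ u =ᵐ[Measure.pi μ] fun x => ∏ i, u i (x i) :=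
  MemLp.coeFn_toLp (memLp_two_prod_eval μ fun i => Lp.memLp (u i))

theorem inner_piTensor (u v : ∀ i, Lp ℝ 2 (μ i)) :
    inner ℝ (piTensor μ u) (piTensor μ v) = ∏ i, inner ℝ (u i) (v i) := by
  simp only [L2.inner_def]
  rw [← integral_fintype_prod_eq_prod (fun i y => inner ℝ (u i y) (v i y))]
  apply integral_congr_ae
  filter_upwards [coeFn_piTensor μ u, coeFn_piTensor μ v] with x h1 h2
  rw [h1, h2]
  simp [Finset.prod_mul_distrib]

end PiTensor

/-! ### Products of functions of complementary groups of variables -/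

section SplitTensor

variable {ι : Type*} [Fintype ι] {X : ι → Type*} [∀ i, MeasurableSpace (X i)]
  (μ : ∀ i, Measure (X i)) [∀ i, SigmaFinite (μ i)]
  {p q : ι → Prop} [DecidablePred p] [DecidablePred q]

/-- Two predicates `p` and `q` are carried along, instead of `p` and its negation, so that the
results apply verbatim to `FirstIdx` and `LastIdx`. -/
theorem measurePreserving_restrict_prod (hpq : ∀ i, q i ↔ ¬ p i) :
    MeasurePreserving (fun x : ∀ i, X i =>
        ((fun i : {i // p i} => x i), (fun i : {i // q i} => x i)))
      (Measure.pi μ)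
      ((Measure.pi fun i : {i // p i} => μ i).prod (Measure.pi fun i : {i // q i} => μ i)) := by
  obtain rfl : q = fun i => ¬ p i := funext fun i => propext (hpq i)
  rename_i inst
  obtain rfl : inst = fun i => instDecidableNot := Subsingleton.elim _ _
  exact measurePreserving_piEquivPiSubtypeProd μ p

theorem memLp_two_mul_prod {Y Z : Type*} [MeasurableSpace Y] [MeasurableSpace Z] {ν : Measure Y}
    {κ : Measure Z} [SigmaFinite ν] [SigmaFinite κ] {f : Y → ℝ} {g : Z → ℝ} (hf : MemLp f 2 ν)
    (hg : MemLp g 2 κ) : MemLp (fun z : Y × Z => f z.1 * g z.2) 2 (ν.prod κ) := by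
  have hm : AEStronglyMeasurable (fun z : Y × Z => f z.1 * g z.2) (ν.prod κ) :=
    hf.1.comp_fst.mul hg.1.comp_snd
  rw [memLp_two_iff_integrable_sq hm]
  simp only [mul_pow]
  exact ((memLp_two_iff_integrable_sq hf.1).1 hf).mul_prod ((memLp_two_iff_integrable_sq hg.1).1 hg)

theorem memLp_two_mul_restrict (hpq : ∀ i, q i ↔ ¬ p i)
    {f : (∀ i : {i // p i}, X i) → ℝ} {g : (∀ i : {i // q i}, X i) → ℝ}
    (hf : MemLp f 2 (Measure.pi fun i : {i // p i} => μ i))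
    (hg : MemLp g 2 (Measure.pi fun i : {i // q i} => μ i)) :
    MemLp (fun x : ∀ i, X i => f (fun i => x i) * g (fun i => x i)) 2 (Measure.pi μ) :=
  (memLp_two_mul_prod hf hg).comp_measurePreserving (measurePreserving_restrict_prod μ hpq)

theorem quasiMeasurePreserving_restrict_left (hpq : ∀ i, q i ↔ ¬ p i) :
    Measure.QuasiMeasurePreserving (fun (x : ∀ i, X i) (i : {i // p i}) => x i)
      (Measure.pi μ) (Measure.pi fun i : {i // p i} => μ i) :=
  Measure.quasiMeasurePreserving_fst.comp
    (measurePreserving_restrict_prod μ hpq).quasiMeasurePreserving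

theorem quasiMeasurePreserving_restrict_right (hpq : ∀ i, q i ↔ ¬ p i) :
    Measure.QuasiMeasurePreserving (fun (x : ∀ i, X i) (i : {i // q i}) => x i)
      (Measure.pi μ) (Measure.pi fun i : {i // q i} => μ i) :=
  Measure.quasiMeasurePreserving_snd.comp
    (measurePreserving_restrict_prod μ hpq).quasiMeasurePreserving

/-- The function `x ↦ f(x_i, p i) g(x_i, q i)`, bilinear in `f` and `g`. -/
noncomputable def splitTensor (hpq : ∀ i, q i ↔ ¬ p i) :
    Lp ℝ 2 (Measure.pi fun i : {i // p i} => μ i) →ₗ[ℝ]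
    Lp ℝ 2 (Measure.pi fun i : {i // q i} => μ i) →ₗ[ℝ] Lp ℝ 2 (Measure.pi μ) :=
  have hae : ∀ f g, (memLp_two_mul_restrict μ hpq (Lp.memLp f) (Lp.memLp g)).toLp _
      =ᵐ[Measure.pi μ] _ := fun f g =>
    MemLp.coeFn_toLp (memLp_two_mul_restrict μ hpq (Lp.memLp f) (Lp.memLp g))
  LinearMap.mk₂ ℝ (fun f g => (memLp_two_mul_restrict μ hpq (Lp.memLp f) (Lp.memLp g)).toLp _)
    (fun f f' g => by
      apply Lp.ext
      refine (hae _ _).trans (EventuallyEq.trans ?_ (Lp.coeFn_add _ _).symm)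
      filter_upwards [hae f g, hae f' g, (quasiMeasurePreserving_restrict_left μ hpq).ae_eq_comp
        (Lp.coeFn_add f f')] with x h1 h2 h3
      simp only [Function.comp_apply, Pi.add_apply] at h3
      rw [Pi.add_apply, h1, h2, h3, add_mul])
    (fun c f g => by
      apply Lp.ext
      refine (hae _ _).trans (EventuallyEq.trans ?_ (Lp.coeFn_smul _ _).symm)
      filter_upwards [hae f g, (quasiMeasurePreserving_restrict_left μ hpq).ae_eq_comp
        (Lp.coeFn_smul c f)] with x h1 h3
      simp only [Function.comp_apply, Pi.smul_apply, smul_eq_mul] at h3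
      rw [Pi.smul_apply, h1, h3, smul_eq_mul, mul_assoc])
    (fun f g g' => by
      apply Lp.ext
      refine (hae _ _).trans (EventuallyEq.trans ?_ (Lp.coeFn_add _ _).symm)
      filter_upwards [hae f g, hae f g', (quasiMeasurePreserving_restrict_right μ hpq).ae_eq_comp
        (Lp.coeFn_add g g')] with x h1 h2 h3
      simp only [Function.comp_apply, Pi.add_apply] at h3
      rw [Pi.add_apply, h1, h2, h3, mul_add])
    (fun c f g => by
      apply Lp.ext
      refine (hae _ _).trans (EventuallyEq.trans ?_ (Lp.coeFn_smul _ _).symm)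
      filter_upwards [hae f g, (quasiMeasurePreserving_restrict_right μ hpq).ae_eq_comp
        (Lp.coeFn_smul c g)] with x h1 h3
      simp only [Function.comp_apply, Pi.smul_apply, smul_eq_mul] at h3
      rw [Pi.smul_apply, h1, h3, smul_eq_mul, mul_left_comm])

theorem coeFn_splitTensor (hpq : ∀ i, q i ↔ ¬ p i)
    (f : Lp ℝ 2 (Measure.pi fun i : {i // p i} => μ i))
    (g : Lp ℝ 2 (Measure.pi fun i : {i // q i} => μ i)) :
    splitTensor μ hpq f g =ᵐ[Measure.pi μ] fun x => f (fun i => x i) * g (fun i => x i) :=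
  MemLp.coeFn_toLp (memLp_two_mul_restrict μ hpq (Lp.memLp f) (Lp.memLp g))

theorem piTensor_eq_splitTensor (hpq : ∀ i, q i ↔ ¬ p i) (u : ∀ i, Lp ℝ 2 (μ i)) :
    piTensor μ u = splitTensor μ hpq (piTensor (fun i : {i // p i} => μ i) fun i => u i)
      (piTensor (fun i : {i // q i} => μ i) fun i => u i) := by
  apply Lp.ext
  filter_upwards [coeFn_piTensor μ u, coeFn_splitTensor μ hpq
      (piTensor (fun i : {i // p i} => μ i) fun i => u i)
      (piTensor (fun i : {i // q i} => μ i) fun i => u i),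
    (quasiMeasurePreserving_restrict_left μ hpq).ae_eq_comp
      (coeFn_piTensor (fun i : {i // p i} => μ i) fun i => u i),
    (quasiMeasurePreserving_restrict_right μ hpq).ae_eq_comp
      (coeFn_piTensor (fun i : {i // q i} => μ i) fun i => u i)] with x h1 h2 h3 h4
  simp only [Function.comp_apply] at h3 h4
  rw [h1, h2, h3, h4]
  obtain rfl : q = fun i => ¬ p i := funext fun i => propext (hpq i)
  rw [← Fintype.prod_subtype_mul_prod_subtype p fun i => u i (x i)]
  congr!

end SplitTensor

/-! ### Sums of few separable terms -/

section Separable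

variable {M N K : Type*} [AddCommGroup M] [Module ℝ M] [AddCommGroup N] [Module ℝ N]
  [AddCommGroup K] [Module ℝ K]

/-- `z` is a sum of `R` values of the bilinear map `B`. -/
def IsSeparableSum (B : M →ₗ[ℝ] N →ₗ[ℝ] K) (R : ℕ) (z : K) : Prop :=
  ∃ (e : Fin R → M) (y : Fin R → N), z = ∑ k, B (e k) (y k)

variable {B : M →ₗ[ℝ] N →ₗ[ℝ] K}

theorem IsSeparableSum.zero (R : ℕ) : IsSeparableSum B R 0 := ⟨0, 0, by simp⟩

theorem IsSeparableSum.add {R S : ℕ} {z w : K} (hz : IsSeparableSum B R z) (hw : IsSeparableSum B S w) :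
    IsSeparableSum B (R + S) (z + w) := by
  obtain ⟨e, y, rfl⟩ := hz
  obtain ⟨e', y', rfl⟩ := hw
  exact ⟨Fin.append e e', Fin.append y y', by simp [Fin.sum_univ_add]⟩

theorem IsSeparableSum.mono {R S : ℕ} (h : R ≤ S) {z : K} (hz : IsSeparableSum B R z) :
    IsSeparableSum B S z := by
  have := hz.add (IsSeparableSum.zero (B := B) (S - R))
  rwa [add_zero, Nat.add_sub_cancel' h] at this

theorem IsSeparableSum.sum {κ : Type*} (A : Finset κ) {d : κ → ℕ} {z : κ → K}
    (h : ∀ a ∈ A, IsSeparableSum B (d a) (z a)) : IsSeparableSum B (∑ a ∈ A, d a) (∑ a ∈ A, z a) := by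
  classical
  induction A using Finset.induction_on with
  | empty => simpa using IsSeparableSum.zero 0
  | insert a A ha ih =>
    rw [Finset.sum_insert ha, Finset.sum_insert ha]
    exact (h a (Finset.mem_insert_self a A)).add
      (ih fun b hb => h b (Finset.mem_insert_of_mem hb))

/-- Expanding each `x a` in a basis of `F` and moving the coordinates into the second factor leaves
one term per basis vector, however many summands there are. -/
theorem IsSeparableSum.of_left_mem {κ : Type*} (A : Finset κ) {x : κ → M} {y : κ → N}
    (F : Submodule ℝ M) [FiniteDimensional ℝ F] (hx : ∀ a ∈ A, x a ∈ F) :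
    IsSeparableSum B (Module.finrank ℝ F) (∑ a ∈ A, B (x a) (y a)) := by
  classical
  let b := Module.finBasis ℝ F
  let x' : κ → F := fun a => if h : x a ∈ F then ⟨x a, h⟩ else 0
  refine ⟨fun k => b k, fun k => ∑ a ∈ A, b.repr (x' a) k • y a, ?_⟩
  simp only [map_sum, map_smul]
  rw [Finset.sum_comm]
  refine Finset.sum_congr rfl fun a ha => ?_
  have h1 : x a = ∑ k, b.repr (x' a) k • (b k : M) := by
    have := congrArg F.subtype (b.sum_repr (x' a))
    rw [map_sum, show F.subtype (x' a) = x a by simp [x', hx a ha]] at this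
    exact this.symm
  rw [h1]
  simp [LinearMap.sum_apply]

theorem IsSeparableSum.flip {R : ℕ} {z : K} (h : IsSeparableSum B.flip R z) : IsSeparableSum B R z := by
  obtain ⟨e, y, rfl⟩ := h
  exact ⟨y, e, by simp⟩

theorem IsSeparableSum.of_right_mem {κ : Type*} (A : Finset κ) {x : κ → M} {y : κ → N}
    (F : Submodule ℝ N) [FiniteDimensional ℝ F] (hy : ∀ a ∈ A, y a ∈ F) :
    IsSeparableSum B (Module.finrank ℝ F) (∑ a ∈ A, B (x a) (y a)) := by
  refine IsSeparableSum.flip ?_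
  simpa using IsSeparableSum.of_left_mem (B := B.flip) A (x := y) (y := x) F hy

/-- The values of a multilinear map on a product of finite dimensional subspaces lie in a subspace
whose dimension is at most the product of the dimensions. -/
theorem exists_finiteDimensional_multilinear_mem {ι : Type*} [Fintype ι] {E : ι → Type*}
    [∀ i, AddCommGroup (E i)] [∀ i, Module ℝ (E i)] (T : MultilinearMap ℝ E M)
    (V : ∀ i, Submodule ℝ (E i)) [∀ i, FiniteDimensional ℝ (V i)] :
    ∃ F : Submodule ℝ M, FiniteDimensional ℝ F ∧
      Module.finrank ℝ F ≤ ∏ i, Module.finrank ℝ (V i) ∧ ∀ v, (∀ i, v i ∈ V i) → T v ∈ F := by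
  classical
  let b := fun i => Module.finBasis ℝ (V i)
  let e : (∀ i, Fin (Module.finrank ℝ (V i))) → M := fun κ => T fun i => (b i (κ i) : E i)
  refine ⟨Submodule.span ℝ (Set.range e), FiniteDimensional.span_of_finite ℝ (Set.finite_range e), ?_,
    fun v hv => ?_⟩
  · refine (finrank_range_le_card e).trans ?_
    simp
  · have h1 : v = fun i => ∑ k, (b i).repr ⟨v i, hv i⟩ k • (b i k : E i) := by
      ext1 i
      have := congrArg (V i).subtype ((b i).sum_repr ⟨v i, hv i⟩)
      rw [map_sum] at this
      exact this.symm
    rw [h1, T.map_sum]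
    refine Submodule.sum_mem _ fun κ _ => ?_
    rw [T.map_smul_univ]
    exact Submodule.smul_mem _ _ (Submodule.subset_span ⟨κ, rfl⟩)

end Separable

/-! ### Monotonicity of Hadamard products of Gram matrices -/

section Gram

variable {κ : Type*} [Fintype κ]

theorem dotProduct_mulVec_eq_form (A : Matrix κ κ ℝ) (c : κ → ℝ) :
    star c ⬝ᵥ A.mulVec c = ∑ p, ∑ q, c p * c q * A p q := by
  simp only [dotProduct, Matrix.mulVec, Finset.mul_sum, Pi.star_apply, star_trivial]
  refine Finset.sum_congr rfl fun p _ => Finset.sum_congr rfl fun q _ => ?_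
  ring

theorem posSemidef_of_form_nonneg {A : Matrix κ κ ℝ} (hA : ∀ p q, A p q = A q p)
    (h : ∀ c : κ → ℝ, 0 ≤ ∑ p, ∑ q, c p * c q * A p q) : A.PosSemidef := by
  refine Matrix.PosSemidef.of_dotProduct_mulVec_nonneg (Matrix.IsHermitian.ext fun p q => ?_) ?_
  · simpa using hA q p
  · intro c
    rw [dotProduct_mulVec_eq_form]
    exact h c

theorem form_nonneg_of_posSemidef {A : Matrix κ κ ℝ} (hA : A.PosSemidef) (c : κ → ℝ) :
    0 ≤ ∑ p, ∑ q, c p * c q * A p q := by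
  rw [← dotProduct_mulVec_eq_form]
  exact hA.dotProduct_mulVec_nonneg c

/-- The Schur product theorem, applied inductively: Hadamard products respect the Loewner order on
positive semidefinite matrices. Both claims are needed together to run the induction. -/
theorem posSemidef_prod_and_prod_sub_prod {ι : Type*} (S : Finset ι) {G H : ι → Matrix κ κ ℝ}
    (hG : ∀ i, (G i).PosSemidef) (hGH : ∀ i, (H i - G i).PosSemidef) :
    (Matrix.of fun p q => ∏ i ∈ S, G i p q).PosSemidef ∧
    (Matrix.of fun p q => ∏ i ∈ S, H i p q - ∏ i ∈ S, G i p q).PosSemidef := by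
  classical
  induction S using Finset.induction_on with
  | empty =>
    refine ⟨posSemidef_of_form_nonneg (by simp) fun c => ?_,
      posSemidef_of_form_nonneg (by simp) fun c => by simp⟩
    simpa [← Finset.mul_sum, ← Finset.sum_mul] using mul_self_nonneg (∑ p, c p)
  | insert i S hi ih =>
    obtain ⟨h1, h2⟩ := ih
    refine ⟨?_, ?_⟩
    · have e : (Matrix.of fun p q => ∏ j ∈ insert i S, G j p q) =
          (G i).hadamard (Matrix.of fun p q => ∏ j ∈ S, G j p q) := by
        ext p q
        simp [Finset.prod_insert hi]
      rw [e]
      exact (hG i).hadamard h1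
    -- With `H'`, `G'` the products over `S`: `H_i H' - G_i G' = (H_i - G_i) H' + G_i (H' - G')`,
    -- where `H' = (H' - G') + G'` is positive semidefinite.
    · have h := ((hGH i).hadamard (h2.add h1)).add ((hG i).hadamard h2)
      refine Eq.mp (congrArg Matrix.PosSemidef ?_) h
      ext p q
      simp only [Finset.prod_insert hi, Matrix.of_apply, Matrix.add_apply, Matrix.hadamard_apply,
        Matrix.sub_apply]
      ring

theorem form_prod_le_form_prod {ι : Type*} [Fintype ι] {G H : ι → Matrix κ κ ℝ}
    (hG : ∀ i, (G i).PosSemidef) (hGH : ∀ i, (H i - G i).PosSemidef) (c : κ → ℝ) :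
    ∑ p, ∑ q, c p * c q * ∏ i, G i p q ≤ ∑ p, ∑ q, c p * c q * ∏ i, H i p q := by
  have h := form_nonneg_of_posSemidef (posSemidef_prod_and_prod_sub_prod Finset.univ hG hGH).2 c
  simpa [mul_sub] using h

end Gram

/-! ### Level decompositions along a hierarchy -/

section Levels

variable {E : Type*} [NormedAddCommGroup E] [InnerProductSpace ℝ E]

theorem norm_sub_starProjection_eq_infDist (U : Submodule ℝ E) [U.HasOrthogonalProjection] (u : E) :
    ‖u - U.starProjection u‖ = Metric.infDist u U := by
  rw [Submodule.starProjection_minimal, Metric.infDist_eq_iInf]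
  simp only [dist_eq_norm]
  rfl

theorem inner_level_eq_zero {U : ℕ → Submodule ℝ E} (hU : Monotone U)
    [∀ j, (U j).HasOrthogonalProjection] {j k : ℕ} (hjk : j < k) (u v : E) :
    inner ℝ ((U (j + 1)).starProjection u - (U j).starProjection u)
      ((U (k + 1)).starProjection v - (U k).starProjection v) = 0 := by
  have h1 : (U (j + 1)).starProjection u - (U j).starProjection u ∈ U k :=
    hU hjk (Submodule.sub_mem _ (Submodule.starProjection_apply_mem _ _)
      (hU j.le_succ (Submodule.starProjection_apply_mem _ _)))
  have h2 : (U (k + 1)).starProjection v - (U k).starProjection v ∈ (U k)ᗮ := by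
    have e : (U (k + 1)).starProjection v - (U k).starProjection v =
        (v - (U k).starProjection v) - (v - (U (k + 1)).starProjection v) := by abel
    rw [e]
    exact Submodule.sub_mem _ (Submodule.sub_starProjection_mem_orthogonal _)
      (Submodule.orthogonal_le (hU k.le_succ) (Submodule.sub_starProjection_mem_orthogonal _))
  exact Submodule.inner_right_of_mem_orthogonal h1 h2

/-- The level component is the `W`-projection of `u - P_U u`, so it is controlled by the distance to
the smaller space alone, even for `W = ⊤`. -/
theorem norm_level_le {U W : Submodule ℝ E} (hUW : U ≤ W) [U.HasOrthogonalProjection]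
    [W.HasOrthogonalProjection] (u : E) :
    ‖W.starProjection u - U.starProjection u‖ ≤ ‖u - U.starProjection u‖ := by
  have e : W.starProjection u - U.starProjection u = W.starProjection (u - U.starProjection u) := by
    rw [map_sub, Submodule.starProjection_eq_self_iff.2
      (hUW (Submodule.starProjection_apply_mem U u))]
  rw [e]
  exact Submodule.norm_starProjection_apply_le _ _

/-- The chain `0 ⊆ V_0 ⊆ ⋯ ⊆ V_{J-1} ⊆ E ⊆ E ⊆ ⋯`. -/
def truncatedChain (V : ℕ → Submodule ℝ E) (J : ℕ) : ℕ → Submodule ℝ E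
  | 0 => ⊥
  | j + 1 => if j < J then V j else ⊤

theorem truncatedChain_monotone {V : ℕ → Submodule ℝ E} (hV : Monotone V) (J : ℕ) :
    Monotone (truncatedChain V J) := by
  refine monotone_nat_of_le_succ fun j => ?_
  cases j with
  | zero => exact bot_le
  | succ j =>
    simp only [truncatedChain]
    split_ifs with h1 h2 h2
    · exact hV j.le_succ
    · exact le_top
    · omega
    · exact le_rfl

theorem truncatedChain_hasOrthogonalProjection {V : ℕ → Submodule ℝ E}
    (hV : ∀ j, FiniteDimensional ℝ (V j)) (J j : ℕ) :
    (truncatedChain V J j).HasOrthogonalProjection := by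
  cases j with
  | zero => simp only [truncatedChain]; infer_instance
  | succ j =>
    simp only [truncatedChain]
    split_ifs
    · infer_instance
    · infer_instance

/-- An orthogonal decomposition of the identity into `J + 1` levels, the last of which collects
everything beyond `V_{J-1}`. -/
theorem exists_level_decomposition {V : ℕ → Submodule ℝ E} (hV : Monotone V)
    (hfin : ∀ j, FiniteDimensional ℝ (V j)) (J : ℕ) :
    ∃ D : ℕ → E →ₗ[ℝ] E, (∀ u, ∑ j ∈ Finset.range (J + 1), D j u = u) ∧
      (∀ j < J, ∀ u, D j u ∈ V j) ∧
      (∀ j k, j ≠ k → ∀ u v, inner ℝ (D j u) (D k v) = 0) ∧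
      (∀ u, ‖D 0 u‖ ≤ ‖u‖) ∧ ∀ j < J, ∀ u, ‖D (j + 1) u‖ ≤ Metric.infDist u (V j) := by
  have hU := truncatedChain_monotone hV J
  have := truncatedChain_hasOrthogonalProjection hfin J
  set U := truncatedChain V J with hUdef
  have hsucc : ∀ j < J, U (j + 1) = V j := fun j hj => by simp [hUdef, truncatedChain, hj]
  -- The chain `U` is shifted by one against `V`: for `j < J` level `j` is `P_{V_j} - P_{V_{j-1}}`
  -- with `V_{-1} = 0`, and level `J` is `1 - P_{V_{J-1}}`.
  refine ⟨fun j => ((U (j + 1)).starProjection - (U j).starProjection : E →L[ℝ] E), fun u => ?_,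
    fun j hj u => ?_, fun j k hjk u v => ?_, fun u => ?_, fun j hj u => ?_⟩
  · have h0 : (U 0).starProjection u = 0 := by
      rw [Submodule.starProjection_apply_eq_zero_iff]
      simp [hUdef, truncatedChain]
    have h1 : (U (J + 1)).starProjection u = u := by
      rw [Submodule.starProjection_eq_self_iff]
      simp [hUdef, truncatedChain]
    have := Finset.sum_range_sub (fun j => (U j).starProjection u) (J + 1)
    simpa [h0, h1] using this
  · rw [← hsucc j hj]
    exact Submodule.sub_mem _ (Submodule.starProjection_apply_mem _ _)
      (hU j.le_succ (Submodule.starProjection_apply_mem _ _))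
  · rcases lt_or_gt_of_ne hjk with h | h
    · exact inner_level_eq_zero hU h u v
    · rw [real_inner_comm]
      exact inner_level_eq_zero hU h v u
  · refine (norm_level_le (hU (Nat.zero_le 1)) u).trans_eq ?_
    have h0 : (U 0).starProjection u = 0 := by
      rw [Submodule.starProjection_apply_eq_zero_iff]
      simp [hUdef, truncatedChain]
    rw [h0, sub_zero]
  · refine (norm_level_le (hU (j + 1).le_succ) u).trans_eq ?_
    rw [norm_sub_starProjection_eq_infDist, hsucc j hj]

end Levels

theorem IsMultiscaleHierarchy.exists_levels {n : ℕ} {Ω : Set (EuclideanSpace ℝ (Fin n))}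
    (hΩ : IsOpen Ω) {r : ℕ} {V : ℕ → Submodule ℝ (L2 Ω)} (hV : IsMultiscaleHierarchy Ω r V)
    {s : ℝ} (hs : 0 ≤ s) (hsr : s ≤ r) :
    ∃ C > (0 : ℝ), ∀ J : ℕ, ∃ D : ℕ → L2 Ω →ₗ[ℝ] L2 Ω,
      (∀ u, ∑ j ∈ Finset.range (J + 1), D j u = u) ∧ (∀ j < J, ∀ u, D j u ∈ V j) ∧
      (∀ j k, j ≠ k → ∀ u v, inner ℝ (D j u) (D k v) = 0) ∧
      ∀ j ≤ J, ∀ u, MemSobolev Ω s u →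
        ‖D j u‖ ^ 2 ≤ C * (4 : ℝ) ^ (-(s * j)) * sobolevInner Ω s u u := by
  obtain ⟨C, hC⟩ := hV.approx s hs hsr
  -- The `1` serves level `0`, where only `‖D 0 u‖ ≤ ‖u‖` is available. Level `j + 1` is bounded by
  -- the distance to `V j`, and this index shift costs the factor `4 ^ s`.
  refine ⟨max 1 (C ^ 2 * 4 ^ s), by positivity, fun J => ?_⟩
  obtain ⟨D, h1, h2, h3, h4, h5⟩ := exists_level_decomposition hV.nested hV.finiteDimensional J
  refine ⟨D, h1, h2, h3, fun j hj u hu => ?_⟩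
  have hn := norm_sq_le_sobolevInner hΩ s u
  have h0 : 0 ≤ sobolevInner Ω s u u := (sq_nonneg _).trans hn
  cases j with
  | zero =>
    have : ‖D 0 u‖ ^ 2 ≤ 1 * sobolevInner Ω s u u := by
      rw [one_mul]
      refine le_trans ?_ hn
      gcongr
      exact h4 u
    refine this.trans ?_
    simp only [Nat.cast_zero, mul_zero, neg_zero, Real.rpow_zero, mul_one]
    gcongr
    exact le_max_left _ _
  | succ j =>
    have h6 : ‖D (j + 1) u‖ ≤ C * (2 : ℝ) ^ (-((j : ℝ) * s)) * sobolevNorm Ω s u :=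
      (h5 j hj u).trans (hC j u hu)
    have h7 : ‖D (j + 1) u‖ ^ 2 ≤ (C * (2 : ℝ) ^ (-((j : ℝ) * s)) * sobolevNorm Ω s u) ^ 2 := by
      gcongr
    refine h7.trans ?_
    rw [mul_pow, sobolevNorm, Real.sq_sqrt h0]
    gcongr
    have e : ((2 : ℝ) ^ (-((j : ℝ) * s))) ^ 2 = 4 ^ s * 4 ^ (-(s * ((j + 1 : ℕ) : ℝ))) := by
      rw [← Real.rpow_add (by norm_num), ← Real.rpow_natCast, ← Real.rpow_mul (by norm_num),
        show (4 : ℝ) = 2 ^ (2 : ℝ) by norm_num, ← Real.rpow_mul (by norm_num)]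
      congr 1
      push_cast
      ring
    rw [mul_pow, e, ← mul_assoc]
    gcongr
    exact le_max_right _ _

/-! ### Weighted sums over multi-indices -/

theorem sum_pow_le_of_forall_ge {y : ℝ} (h0 : 0 ≤ y) (h1 : y < 1) {T : Finset ℕ} {k : ℕ}
    (hT : ∀ j ∈ T, k ≤ j) : ∑ j ∈ T, y ^ j ≤ y ^ k / (1 - y) := by
  have hsub : T ⊆ Finset.Ico k (T.sup id + 1) := fun j hj =>
    Finset.mem_Ico.2 ⟨hT j hj, Nat.lt_succ_of_le (Finset.le_sup (f := id) hj)⟩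
  exact (Finset.sum_le_sum_of_subset_of_nonneg hsub fun _ _ _ => pow_nonneg h0 _).trans
    (geom_sum_Ico_le_of_lt_one h0 h1)

theorem sum_exp_neg_le {θ X : ℝ} (hθ : 0 < θ) {T : Finset ℕ} (hT : ∀ j ∈ T, X ≤ θ * j) :
    ∑ j ∈ T, Real.exp (-(θ * j)) ≤ Real.exp (-X) / (1 - Real.exp (-θ)) := by
  have hy : Real.exp (-θ) < 1 := by simpa using hθ
  have e : ∀ j : ℕ, Real.exp (-(θ * j)) = Real.exp (-θ) ^ j := fun j => by
    rw [← Real.exp_nat_mul]; ring_nf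
  simp only [e]
  refine (sum_pow_le_of_forall_ge (k := ⌈X / θ⌉₊) (Real.exp_nonneg _) hy fun j hj => ?_).trans ?_
  · refine Nat.ceil_le.2 ?_
    rw [div_le_iff₀ hθ, mul_comm]
    exact hT j hj
  · have : 0 < 1 - Real.exp (-θ) := by linarith
    gcongr
    rw [← e]
    apply Real.exp_le_exp.2
    have := Nat.le_ceil (X / θ)
    rw [div_le_iff₀ hθ] at this
    linarith

/-- Read backwards from its largest index, the sum is dominated by a decreasing geometric series. -/
theorem sum_exp_le {θ X : ℝ} (hθ : 0 < θ) {T : Finset ℕ} (hT : ∀ j ∈ T, θ * j ≤ X) :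
    ∑ j ∈ T, Real.exp (θ * j) ≤ Real.exp X / (1 - Real.exp (-θ)) := by
  have hy : Real.exp (-θ) < 1 := by simpa using hθ
  have hpos : 0 < 1 - Real.exp (-θ) := by linarith
  rcases T.eq_empty_or_nonempty with rfl | hne
  · simp; positivity
  set m := T.max' hne
  have hle : ∀ j ∈ T, j ≤ m := fun j hj => T.le_max' j hj
  have hm : θ * m ≤ X := hT m (T.max'_mem hne)
  have h1 : ∑ j ∈ T, Real.exp (θ * j) ≤ ∑ j ∈ Finset.range (m + 1), Real.exp (θ * j) :=
    Finset.sum_le_sum_of_subset_of_nonneg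
      (fun j hj => Finset.mem_range.2 (Nat.lt_succ_of_le (hle j hj)))
      fun _ _ _ => Real.exp_nonneg _
  refine h1.trans ?_
  rw [← Finset.sum_range_reflect]
  have h2 : ∀ j ∈ Finset.range (m + 1), Real.exp (θ * ((m + 1 - 1 - j : ℕ) : ℝ)) =
      Real.exp (θ * m) * Real.exp (-(θ * j)) := by
    intro j hj
    have : j ≤ m := Nat.lt_succ_iff.1 (Finset.mem_range.1 hj)
    rw [Nat.add_sub_cancel, Nat.cast_sub this, ← Real.exp_add]
    ring_nf
  rw [Finset.sum_congr rfl h2, ← Finset.mul_sum]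
  have h3 := sum_exp_neg_le (X := 0) hθ (T := Finset.range (m + 1)) fun j _ => by positivity
  rw [neg_zero, Real.exp_zero] at h3
  calc _ ≤ Real.exp X * (1 / (1 - Real.exp (-θ))) := by gcongr
    _ = _ := by ring

/-- From `e^x ≥ 1 + x`. For a ratio `e^{-θ/(1+K)}` this bounds the geometric series by a multiple of
`1 + K`, the source of the logarithms. -/
theorem one_div_one_sub_exp_neg_le {x : ℝ} (hx : 0 < x) :
    1 / (1 - Real.exp (-x)) ≤ 1 + 1 / x := by
  have hy : Real.exp (-x) < 1 := by simpa using hx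
  rw [div_le_iff₀ (by linarith)]
  have h := Real.add_one_le_exp x
  have h2 : Real.exp (-x) * (x + 1) ≤ 1 := by
    calc Real.exp (-x) * (x + 1) ≤ Real.exp (-x) * Real.exp x := by gcongr
      _ = 1 := by rw [← Real.exp_add]; simp
  have h3 : (1 + 1 / x) * (1 - Real.exp (-x)) - 1 = (1 - Real.exp (-x) * (x + 1)) / x := by
    field_simp; ring
  have h4 : 0 ≤ (1 - Real.exp (-x) * (x + 1)) / x := div_nonneg (by linarith) hx.le
  linarith

section MultiIndex

variable {ι : Type*} [Fintype ι] [DecidableEq ι]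

/-- Splitting off the index `i₀` in a sum over multi-indices. -/
theorem sum_le_sum_update (i₀ : ι) (S : Finset (ι → ℕ)) (F G : (ι → ℕ) → ℝ)
    (hG : ∀ a, 0 ≤ G a)
    (h : ∀ a : ι → ℕ, a i₀ = 0 → ∀ T : Finset ℕ, (∀ j ∈ T, Function.update a i₀ j ∈ S) →
      ∑ j ∈ T, F (Function.update a i₀ j) ≤ G a) :
    ∃ M : ℕ, ∑ a ∈ S, F a ≤
      ∑ a ∈ Fintype.piFinset fun i => Finset.range (if i = i₀ then 1 else M), G a := by
  let M := S.sup (fun a => Finset.univ.sup a) + 1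
  have hM : ∀ a ∈ S, ∀ i, a i < M := fun a ha i =>
    Nat.lt_succ_of_le ((Finset.le_sup (f := a) (Finset.mem_univ i)).trans
      (Finset.le_sup (f := fun a : ι → ℕ => Finset.univ.sup a) ha))
  refine ⟨M, ?_⟩
  rw [← Finset.sum_fiberwise_of_maps_to (g := fun a => Function.update a i₀ 0)
    (t := Fintype.piFinset fun i => Finset.range (if i = i₀ then 1 else M))]
  · refine Finset.sum_le_sum fun a' _ => ?_
    rcases (S.filter fun a => Function.update a i₀ 0 = a').eq_empty_or_nonempty with he | ⟨a₁, ha₁⟩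
    · rw [he, Finset.sum_empty]; exact hG a'
    have hupd : ∀ a ∈ S.filter (fun a => Function.update a i₀ 0 = a'),
        Function.update a' i₀ (a i₀) = a := by
      intro a ha
      rw [← (Finset.mem_filter.1 ha).2]
      simp
    have hinj : Set.InjOn (fun a : ι → ℕ => a i₀)
        (S.filter fun a => Function.update a i₀ 0 = a') := by
      intro a ha b hb hab
      rw [← hupd a ha, ← hupd b hb]
      exact congrArg _ hab
    have e : ∑ a ∈ S.filter (fun a => Function.update a i₀ 0 = a'), F a =
        ∑ j ∈ (S.filter fun a => Function.update a i₀ 0 = a').image (fun a => a i₀),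
          F (Function.update a' i₀ j) := by
      rw [Finset.sum_image hinj]
      exact Finset.sum_congr rfl fun a ha => by rw [hupd a ha]
    rw [e]
    refine h a' ?_ _ fun j hj => ?_
    · rw [← (Finset.mem_filter.1 ha₁).2]; simp
    · obtain ⟨a, ha, rfl⟩ := Finset.mem_image.1 hj
      rw [hupd a ha]
      exact (Finset.mem_filter.1 ha).1
  · intro a ha
    rw [Fintype.mem_piFinset]
    intro i
    rw [Finset.mem_range]
    by_cases hi : i = i₀
    · subst hi; simp
    · simpa [hi] using hM a ha i

theorem sum_mul_update (i₀ : ι) (θ : ι → ℝ) {a : ι → ℕ} (ha : a i₀ = 0) (j : ℕ) :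
    ∑ i, θ i * (Function.update a i₀ j i : ℕ) = ∑ i, θ i * a i + θ i₀ * j := by
  rw [← Finset.add_sum_erase _ _ (Finset.mem_univ i₀),
    ← Finset.add_sum_erase (a := i₀) _ (fun i => θ i * (a i : ℝ)) (Finset.mem_univ i₀), ha,
    Function.update_self]
  have : ∑ i ∈ Finset.univ.erase i₀, θ i * (Function.update a i₀ j i : ℕ) =
      ∑ i ∈ Finset.univ.erase i₀, θ i * (a i : ℝ) :=
    Finset.sum_congr rfl fun i hi => by rw [Function.update_of_ne (Finset.ne_of_mem_erase hi)]
  rw [this]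
  push_cast
  ring

/-- The sum is a product of geometric series. A coordinate with `δ i > 0` contributes a constant
free of `K`, and one with `δ i = 0` is summable only through the damping `θ i / (1 + K)` and
contributes a multiple of `1 + K`. The coordinate `i₀`, summed out beforehand, is frozen at `0`. The
damping replaces lattice point counting in the two lemmas below. -/
theorem sum_exp_damped_le (i₀ : ι) {δ θ : ι → ℝ} (hδ : ∀ i, 0 ≤ δ i) (hθ : ∀ i, 0 < θ i) :
    ∃ C > (0 : ℝ), ∀ (K : ℝ), 0 ≤ K → ∀ M : ℕ,
      ∑ a ∈ Fintype.piFinset fun i => Finset.range (if i = i₀ then 1 else M),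
        Real.exp (-∑ i, (δ i + θ i / (1 + K)) * (a i : ℝ)) ≤
      C * (1 + K) ^ (Finset.univ.filter fun i => i ≠ i₀ ∧ δ i = 0).card := by
  let c : ι → ℝ := fun i => if δ i = 0 then 1 + 1 / θ i else 1 / (1 - Real.exp (-δ i))
  have hc : ∀ i, 0 < c i := by
    intro i
    simp only [c]
    split_ifs with h
    · have := hθ i; positivity
    · have h1 : 0 < δ i := lt_of_le_of_ne (hδ i) (Ne.symm h)
      have : Real.exp (-δ i) < 1 := by simpa using h1
      exact one_div_pos.2 (by linarith)
  refine ⟨∏ i, (if i = i₀ then 1 else c i), Finset.prod_pos fun i _ => ?_, fun K hK M => ?_⟩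
  · split_ifs; exacts [one_pos, hc i]
  have h1K : 0 < 1 + K := by linarith
  have e : ∀ a : ι → ℕ, Real.exp (-∑ i, (δ i + θ i / (1 + K)) * (a i : ℝ)) =
      ∏ i, Real.exp (-((δ i + θ i / (1 + K)) * (a i : ℝ))) := fun a => by
    rw [← Real.exp_sum, Finset.sum_neg_distrib]
  simp only [e]
  rw [← Finset.prod_univ_sum (fun i => Finset.range (if i = i₀ then 1 else M))
    (fun i j => Real.exp (-((δ i + θ i / (1 + K)) * (j : ℝ))))]
  have hfac : ∀ i, ∑ j ∈ Finset.range (if i = i₀ then 1 else M),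
      Real.exp (-((δ i + θ i / (1 + K)) * (j : ℝ))) ≤
      (if i = i₀ then 1 else c i) * (if i ≠ i₀ ∧ δ i = 0 then 1 + K else 1) := by
    intro i
    by_cases hi : i = i₀
    · simp [hi]
    simp only [hi, if_false, ne_eq, not_false_eq_true, true_and]
    have hdiv : 0 < θ i / (1 + K) := div_pos (hθ i) h1K
    have hpos : 0 < δ i + θ i / (1 + K) := by linarith [hδ i]
    refine (sum_exp_neg_le (X := 0) hpos fun j _ => by positivity).trans ?_
    rw [neg_zero, Real.exp_zero]
    by_cases hd : δ i = 0
    · simp only [hd, if_true, c, zero_add]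
      refine (one_div_one_sub_exp_neg_le hdiv).trans ?_
      rw [one_div_div, add_mul, one_mul]
      have : (1 + K) / θ i = 1 / θ i * (1 + K) := by ring
      linarith
    · simp only [hd, if_false, c, mul_one]
      have h1 : 0 < δ i := lt_of_le_of_ne (hδ i) (Ne.symm hd)
      have h2 : Real.exp (-δ i) < 1 := by simpa using h1
      have h3 : 0 < 1 - Real.exp (-δ i) := by linarith
      gcongr
      linarith
  refine (Finset.prod_le_prod (fun i _ => Finset.sum_nonneg fun _ _ => Real.exp_nonneg _)
    fun i _ => hfac i).trans_eq ?_
  rw [Finset.prod_mul_distrib]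
  congr 1
  rw [Finset.prod_ite, Finset.prod_const, Finset.prod_const_one, mul_one]

/-- Let `x` be the value of the form on the coordinates other than `i₀`. Summing over the coordinate
`i₀` leaves a multiple of `e^{-max(K, x)}`, which is at most `e · e^{-K} e^{-x/(1+K)}`; the rest is
a damped sum with all `δ i = 0`. -/
theorem sum_exp_tail_le [Nonempty ι] {θ : ι → ℝ} (hθ : ∀ i, 0 < θ i) :
    ∃ C > (0 : ℝ), ∀ (K : ℝ), 0 ≤ K → ∀ S : Finset (ι → ℕ),
      (∀ a ∈ S, K ≤ ∑ i, θ i * a i) →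
      ∑ a ∈ S, Real.exp (-∑ i, θ i * a i) ≤
        C * Real.exp (-K) * (1 + K) ^ (Fintype.card ι - 1) := by
  obtain ⟨i₀⟩ := ‹Nonempty ι›
  obtain ⟨C, hC, hsum⟩ := sum_exp_damped_le i₀ (δ := fun _ => 0) (fun _ => le_rfl) hθ
  have hy : Real.exp (-θ i₀) < 1 := by simpa using hθ i₀
  have hpos : 0 < 1 - Real.exp (-θ i₀) := by linarith
  refine ⟨C * Real.exp 1 / (1 - Real.exp (-θ i₀)), by positivity, fun K hK S hS => ?_⟩
  have h1K : 0 < 1 + K := by linarith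
  obtain ⟨M, hM⟩ := sum_le_sum_update i₀ S (fun a => Real.exp (-∑ i, θ i * a i))
    (fun a => Real.exp 1 * Real.exp (-K) / (1 - Real.exp (-θ i₀)) *
      Real.exp (-∑ i, (0 + θ i / (1 + K)) * (a i : ℝ))) (fun a => by positivity) (by
    intro a ha T hT
    set x := ∑ i, θ i * (a i : ℝ) with hx
    have hx0 : 0 ≤ x := Finset.sum_nonneg fun i _ => mul_nonneg (hθ i).le (Nat.cast_nonneg _)
    have e1 : ∑ i, (0 + θ i / (1 + K)) * (a i : ℝ) = x / (1 + K) := by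
      rw [hx, Finset.sum_div]
      exact Finset.sum_congr rfl fun i _ => by ring
    have e2 : ∀ j : ℕ, Real.exp (-∑ i, θ i * (Function.update a i₀ j i : ℕ)) =
        Real.exp (-x) * Real.exp (-(θ i₀ * j)) := fun j => by
      rw [sum_mul_update i₀ θ ha, ← Real.exp_add, ← hx, neg_add]
    simp only [e2]
    rw [← Finset.mul_sum, e1]
    have h1 := sum_exp_neg_le (X := max (K - x) 0) (hθ i₀) (T := T) (fun j hj => by
      have := hS _ (hT j hj)
      rw [sum_mul_update i₀ θ ha] at this
      exact max_le (by linarith) (mul_nonneg (hθ i₀).le (Nat.cast_nonneg _)))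
    refine (mul_le_mul_of_nonneg_left h1 (Real.exp_nonneg _)).trans ?_
    rw [mul_div_assoc', div_mul_eq_mul_div]
    refine div_le_div_of_nonneg_right ?_ hpos.le
    rw [← Real.exp_add, ← Real.exp_add, ← Real.exp_add]
    apply Real.exp_le_exp.2
    have hm1 := le_max_left (K - x) 0
    have hm2 := le_max_right (K - x) 0
    -- The right side is `max(K, x)`, which dominates the convex combination of `K` and `x` with
    -- weights `K/(1+K)` and `1/(1+K)`.
    have h3 : K + x / (1 + K) - 1 ≤ x + max (K - x) 0 := by
      have h4 : K + x / (1 + K) - 1 = (K / (1 + K)) * (K) + (1 / (1 + K)) * x - 1 / (1 + K) := by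
        field_simp; ring
      have h5 : K / (1 + K) + 1 / (1 + K) = 1 := by field_simp; ring
      have h6 : 0 ≤ K / (1 + K) := by positivity
      have h7 : 0 ≤ 1 / (1 + K) := by positivity
      set w := x + max (K - x) 0
      have h8 := mul_le_mul_of_nonneg_left (show K ≤ w by linarith) h6
      have h9 := mul_le_mul_of_nonneg_left (show x ≤ w by linarith) h7
      have h10 : K / (1 + K) * w + 1 / (1 + K) * w = w := by rw [← add_mul, h5, one_mul]
      linarith
    linarith)
  refine hM.trans ?_
  rw [← Finset.mul_sum]
  refine (mul_le_mul_of_nonneg_left (hsum K hK M) (by positivity)).trans_eq ?_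
  have hcard : (Finset.univ.filter fun i => i ≠ i₀ ∧ (0 : ℝ) = 0).card = Fintype.card ι - 1 := by
    simp only [and_true, Finset.filter_ne']
    rw [Finset.card_erase_of_mem (Finset.mem_univ _), Finset.card_univ]
  rw [hcard]
  ring

/-- Write `x`, `y` for the `θ`- and `ν`-forms on the other coordinates. Summing over a coordinate
`i₀` of steepest growth leaves a multiple of `e^{ρK} e^{-(ρx - y)}`. Since `x ≤ K`, the damping
`e^{-x/(1+K)}` can be inserted at the cost of a factor `e`. Only directions of equally steep growth
have `δ i = ρ θ i - ν i = 0` and yield a power of `1 + K`. -/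
theorem sum_exp_head_le (i₀ : ι) {θ ν : ι → ℝ} (hθ : ∀ i, 0 < θ i) (hν : ∀ i, 0 < ν i) {ρ : ℝ}
    (hρ : ∀ i, ν i ≤ ρ * θ i) (hρ₀ : ν i₀ = ρ * θ i₀) :
    ∃ C > (0 : ℝ), ∀ (K : ℝ), 0 ≤ K → ∀ S : Finset (ι → ℕ),
      (∀ a ∈ S, ∑ i, θ i * a i ≤ K) →
      ∑ a ∈ S, Real.exp (∑ i, ν i * a i) ≤ C * Real.exp (ρ * K) *
        (1 + K) ^ (Finset.univ.filter fun i => i ≠ i₀ ∧ ν i = ρ * θ i).card := by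
  obtain ⟨C, hC, hsum⟩ := sum_exp_damped_le i₀ (δ := fun i => ρ * θ i - ν i)
    (fun i => sub_nonneg.2 (hρ i)) hθ
  have hy : Real.exp (-ν i₀) < 1 := by simpa using hν i₀
  have hpos : 0 < 1 - Real.exp (-ν i₀) := by linarith
  have hρpos : 0 < ρ := by
    have := hν i₀
    rw [hρ₀] at this
    exact (pos_iff_pos_of_mul_pos this).2 (hθ i₀)
  refine ⟨C * Real.exp 1 / (1 - Real.exp (-ν i₀)), by positivity, fun K hK S hS => ?_⟩
  have h1K : 0 < 1 + K := by linarith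
  obtain ⟨M, hM⟩ := sum_le_sum_update i₀ S (fun a => Real.exp (∑ i, ν i * a i))
    (fun a => Real.exp 1 * Real.exp (ρ * K) / (1 - Real.exp (-ν i₀)) *
      Real.exp (-∑ i, (ρ * θ i - ν i + θ i / (1 + K)) * (a i : ℝ))) (fun a => by positivity) (by
    intro a ha T hT
    rcases T.eq_empty_or_nonempty with rfl | ⟨j₁, hj₁⟩
    · simp only [Finset.sum_empty]; positivity
    set x := ∑ i, θ i * (a i : ℝ) with hx
    set y := ∑ i, ν i * (a i : ℝ) with hy
    have hle : ∀ j ∈ T, x + θ i₀ * j ≤ K := fun j hj => by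
      have := hS _ (hT j hj)
      rwa [sum_mul_update i₀ θ ha] at this
    have hxK : x ≤ K := by
      have := hle j₁ hj₁
      have h2 : 0 ≤ θ i₀ * j₁ := mul_nonneg (hθ i₀).le (Nat.cast_nonneg _)
      linarith
    have e1 : ∑ i, (ρ * θ i - ν i + θ i / (1 + K)) * (a i : ℝ) = ρ * x - y + x / (1 + K) := by
      rw [hx, hy, Finset.sum_div, Finset.mul_sum, ← Finset.sum_sub_distrib,
        ← Finset.sum_add_distrib]
      exact Finset.sum_congr rfl fun i _ => by ring
    have e2 : ∀ j : ℕ, Real.exp (∑ i, ν i * (Function.update a i₀ j i : ℕ)) =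
        Real.exp y * Real.exp (ν i₀ * j) := fun j => by
      rw [sum_mul_update i₀ ν ha, ← Real.exp_add]
    simp only [e2]
    rw [← Finset.mul_sum, e1]
    have h1 := sum_exp_le (X := ρ * (K - x)) (hν i₀) (T := T) (fun j hj => by
      have := hle j hj
      rw [hρ₀, mul_assoc]
      gcongr
      linarith)
    refine (mul_le_mul_of_nonneg_left h1 (Real.exp_nonneg _)).trans ?_
    rw [mul_div_assoc', div_mul_eq_mul_div]
    refine div_le_div_of_nonneg_right ?_ hpos.le
    rw [← Real.exp_add, ← Real.exp_add, ← Real.exp_add]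
    apply Real.exp_le_exp.2
    have h3 : x / (1 + K) ≤ 1 := by
      rw [div_le_one h1K]; linarith
    linarith)
  refine hM.trans ?_
  rw [← Finset.mul_sum]
  refine (mul_le_mul_of_nonneg_left (hsum K hK M) (by positivity)).trans_eq ?_
  have hcard : (Finset.univ.filter fun i => i ≠ i₀ ∧ ρ * θ i - ν i = 0) =
      Finset.univ.filter fun i => i ≠ i₀ ∧ ν i = ρ * θ i := by
    ext i
    simp only [Finset.mem_filter, sub_eq_zero, eq_comm]
  rw [hcard]
  ring

end MultiIndex

/-! ### Choice of the index sets -/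

/-- The trivial regime, where the target bound is at least `1` and retaining nothing suffices. The
hypothesis is put in `b`-th powers so as to cover both `b = 0` and `R ≤ c (log R)^p`. -/
theorem one_le_rate {R : ℕ} (hR : 2 ≤ R) {c b : ℝ} (hc : 0 < c) (p k : ℕ)
    (h : (R : ℝ) ^ b ≤ (c * Real.log R ^ p) ^ b) :
    1 ≤ c ^ (2 * b) * (Real.log 2 ^ k)⁻¹ * (R : ℝ) ^ (-(2 * b)) *
      Real.log R ^ ((k : ℝ) + 2 * b * p) := by
  have hR0 : (0 : ℝ) < R := by positivity
  have hl2 : 0 < Real.log 2 := Real.log_pos (by norm_num)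
  have hL : Real.log 2 ≤ Real.log R := Real.log_le_log (by norm_num) (by exact_mod_cast hR)
  have hL0 : 0 < Real.log R := hl2.trans_le hL
  have h1 : (R : ℝ) ^ (2 * b) ≤ (c * Real.log R ^ p) ^ (2 * b) := by
    rw [mul_comm 2 b, Real.rpow_mul hR0.le, Real.rpow_mul (by positivity)]
    exact Real.rpow_le_rpow (by positivity) h (by norm_num)
  have h2 : (c * Real.log R ^ p) ^ (2 * b) = c ^ (2 * b) * Real.log R ^ (2 * b * p) := by
    rw [Real.mul_rpow hc.le (by positivity), ← Real.rpow_natCast, ← Real.rpow_mul hL0.le,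
      mul_comm (p : ℝ)]
  have h3 : 1 ≤ (Real.log 2 ^ k)⁻¹ * Real.log R ^ k := by
    rw [← div_eq_inv_mul, one_le_div (by positivity)]
    gcongr
  have h4 : 1 ≤ (R : ℝ) ^ (-(2 * b)) * (c ^ (2 * b) * Real.log R ^ (2 * b * p)) := by
    rw [Real.rpow_neg hR0.le, ← div_eq_inv_mul, one_le_div (by positivity), ← h2]
    exact h1
  rw [Real.rpow_add hL0, Real.rpow_natCast]
  calc (1 : ℝ) ≤ ((Real.log 2 ^ k)⁻¹ * Real.log R ^ k) *
        ((R : ℝ) ^ (-(2 * b)) * (c ^ (2 * b) * Real.log R ^ (2 * b * p))) :=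
      one_le_mul_of_one_le_of_one_le h3 h4
    _ = _ := by ring

theorem sum_single_level_le {ι : Type*} [Fintype ι] [DecidableEq ι] (s : ι → ℝ) :
    ∑ a ∈ (Fintype.piFinset fun _ : ι => Finset.range (0 + 1)) \ ∅,
      ∏ i, (4 : ℝ) ^ (-(s i * (a i : ℝ))) ≤ 1 := by
  have h : ∀ a ∈ (Fintype.piFinset fun _ : ι => Finset.range (0 + 1)) \ ∅,
      ∏ i, (4 : ℝ) ^ (-(s i * (a i : ℝ))) ≤ 1 := by
    intro a ha
    rw [Finset.sdiff_empty, Fintype.mem_piFinset] at ha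
    refine (Finset.prod_eq_one fun i _ => ?_).le
    have := ha i
    simp only [zero_add, Finset.range_one, Finset.mem_singleton] at this
    simp [this]
  refine (Finset.sum_le_card_nsmul _ _ _ h).trans ?_
  simp

/-- In logarithmic scale the error weights are `e^{-θ·a}` and the dimensions `e^{ν·a}`, with `ν i ≤
θ i / (2b)` and equality exactly where the minimum `b` is attained. The set is the simplex `θ·a ≤
K`, with `K` as large as the dimension budget `R/2` permits, up to constants. -/
theorem exists_index_set {ι : Type} [Fintype ι] [DecidableEq ι] [Nonempty ι] {n : ι → ℕ}
    (hn : ∀ i, 1 ≤ n i) {s : ι → ℝ} (hs : ∀ i, 0 ≤ s i) {c : ι → ℝ} (hc : ∀ i, 0 < c i)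
    {b : ℝ} (hb : b = ⨅ i, s i / n i) {P : ℕ} (hP : P = minCount fun i => s i / n i) :
    ∃ C > (0 : ℝ), ∀ R : ℕ, 2 ≤ R → ∃ (J : ι → ℕ) (A : Finset (ι → ℕ)),
      (∀ a ∈ A, ∀ i, a i < J i) ∧
      ∑ a ∈ A, ∏ i, (c i * (2 : ℝ) ^ (a i * n i)) ≤ (R : ℝ) / 2 ∧
      ∑ a ∈ (Fintype.piFinset fun i => Finset.range (J i + 1)) \ A,
          ∏ i, (4 : ℝ) ^ (-(s i * (a i : ℝ))) ≤
        C * (R : ℝ) ^ (-(2 * b)) *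
          Real.log R ^ ((Fintype.card ι : ℝ) - 1 + 2 * b * ((P : ℝ) - 1)) := by
  have hn0 : ∀ i, (0 : ℝ) < n i := fun i => by exact_mod_cast hn i
  have hl2 : 0 < Real.log 2 := Real.log_pos (by norm_num)
  have hl4 : Real.log 4 = 2 * Real.log 2 := by
    rw [show (4 : ℝ) = 2 ^ 2 by norm_num, Real.log_pow]; norm_num
  have hble : ∀ i, b ≤ s i / n i := fun i => hb ▸ ciInf_le (Set.finite_range _).bddBelow i
  obtain ⟨i₀, hi₀⟩ := exists_eq_ciInf_of_finite (f := fun i => s i / n i)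
  have hbi₀ : s i₀ / n i₀ = b := hi₀.trans hb.symm
  have hb0 : 0 ≤ b := hbi₀ ▸ div_nonneg (hs i₀) (hn0 i₀).le
  set p := (Finset.univ.filter fun i => i ≠ i₀ ∧ s i / n i = b).card with hp
  have hPp : (P : ℝ) - 1 = p := by
    have h1 : P = (Finset.univ.filter fun i => s i / n i = b).card := by
      rw [hP, minCount, ← hb, Nat.card_eq_fintype_card, Fintype.card_subtype]
    have h2 : (Finset.univ.filter fun i => i ≠ i₀ ∧ s i / n i = b) =
        (Finset.univ.filter fun i => s i / n i = b).erase i₀ := by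
      ext i; simp
    have h3 : i₀ ∈ Finset.univ.filter fun i => s i / n i = b := by simp [hbi₀]
    have h4 := Finset.card_erase_add_one h3
    rw [← h2, ← h1, ← hp] at h4
    rw [← h4]; push_cast; ring
  obtain ⟨k, hk⟩ : ∃ k, Fintype.card ι = k + 1 := Nat.exists_eq_succ_of_ne_zero Fintype.card_ne_zero
  have hkr : (Fintype.card ι : ℝ) - 1 = k := by rw [hk]; push_cast; ring
  rw [hkr, hPp]
  -- For `b = 0` nothing is retained: with `J = 0` the only block is `a = 0`, of weight `1`.
  rcases hb0.eq_or_lt with hbz | hbpos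
  · refine ⟨1 ^ (2 * b) * (Real.log 2 ^ k)⁻¹, by positivity, fun R hR =>
      ⟨fun _ => 0, ∅, by simp, by rw [Finset.sum_empty]; positivity, ?_⟩⟩
    refine (sum_single_level_le s).trans (one_le_rate hR one_pos p k ?_)
    rw [← hbz]; simp
  have hspos : ∀ i, 0 < s i := fun i => by
    have := hbpos.trans_le (hble i)
    rw [lt_div_iff₀ (hn0 i), zero_mul] at this
    exact this
  set θ : ι → ℝ := fun i => s i * Real.log 4 with hθdef
  set ν : ι → ℝ := fun i => n i * Real.log 2 with hνdef
  have hθ : ∀ i, 0 < θ i := fun i => mul_pos (hspos i) (by rw [hl4]; positivity)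
  have hν : ∀ i, 0 < ν i := fun i => mul_pos (hn0 i) hl2
  have hνθ : ∀ i, ν i = 1 / (2 * b) * θ i ↔ s i / n i = b := by
    intro i
    simp only [hθdef, hνdef, hl4]
    have h1 := hn0 i
    constructor
    · intro h
      field_simp at h ⊢
      linarith
    · intro h
      rw [← h]
      have h2 := hspos i
      field_simp
  have hνle : ∀ i, ν i ≤ 1 / (2 * b) * θ i := by
    intro i
    simp only [hθdef, hνdef, hl4]
    have h1 := hble i
    rw [le_div_iff₀ (hn0 i)] at h1
    have e : 1 / (2 * b) * (s i * (2 * Real.log 2)) = s i / b * Real.log 2 := by field_simp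
    rw [e]
    gcongr
    rw [le_div_iff₀ hbpos]
    linarith
  obtain ⟨Ct, hCt, htail⟩ := sum_exp_tail_le hθ
  obtain ⟨Ch, hCh, hhead⟩ := sum_exp_head_le i₀ hθ hν hνle ((hνθ i₀).2 hbi₀)
  have hpcard : (Finset.univ.filter fun i => i ≠ i₀ ∧ ν i = 1 / (2 * b) * θ i).card = p := by
    simp only [hνθ, hp]
  rw [hpcard] at hhead
  have hcprod : 0 < ∏ i, c i := Finset.prod_pos fun i _ => hc i
  set c₁ : ℝ := 1 / Real.log 2 + 2 * b with hc₁
  have hc₁pos : 0 < c₁ := by positivity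
  -- The first entry brings the dimension count below `R / 2`; the second gives `d * L ^ p ≥ 1`,
  -- hence `Q ≤ R`, although `log R` may be below `1`.
  set d : ℝ := max (2 * (∏ i, c i) * Ch * c₁ ^ p) (Real.log 2 ^ p)⁻¹ with hd
  have hdpos : 0 < d := lt_max_of_lt_right (by positivity)
  refine ⟨max (d ^ (2 * b) * (Real.log 2 ^ k)⁻¹) (Ct * d ^ (2 * b) * c₁ ^ k),
    lt_max_of_lt_left (by positivity), fun R hR => ?_⟩
  have hR0 : (0 : ℝ) < R := by positivity
  have hL : Real.log 2 ≤ Real.log R := Real.log_le_log (by norm_num) (by exact_mod_cast hR)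
  set L := Real.log R with hLdef
  have hL0 : 0 < L := hl2.trans_le hL
  rcases lt_or_ge (R : ℝ) (d * L ^ p) with hsmall | hlarge
  · refine ⟨fun _ => 0, ∅, by simp, by rw [Finset.sum_empty]; positivity, ?_⟩
    refine (sum_single_level_le s).trans ((one_le_rate hR hdpos p k
      (Real.rpow_le_rpow hR0.le hsmall.le hb0)).trans ?_)
    gcongr
    exact le_max_left _ _
  have hdL : 1 ≤ d * L ^ p := by
    have h1 : 1 ≤ (Real.log 2 ^ p)⁻¹ * L ^ p := by
      rw [← div_eq_inv_mul, one_le_div (by positivity)]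
      gcongr
    refine h1.trans ?_
    gcongr
    exact le_max_right _ _
  have hdL0 : 0 < d * L ^ p := by positivity
  set Q : ℝ := R / (d * L ^ p) with hQ
  have hQ1 : 1 ≤ Q := (one_le_div hdL0).2 hlarge
  have hQ0 : 0 < Q := by linarith
  have hQR : Q ≤ R := div_le_self hR0.le hdL
  -- Chosen so that the leading factor `e^{K/(2b)}` of the dimension count is `Q`; the division by
  -- `L ^ p` in `Q` absorbs the factor `(1 + K) ^ p`.
  set K : ℝ := 2 * b * Real.log Q with hK
  have hK0 : 0 ≤ K := mul_nonneg (by positivity) (Real.log_nonneg hQ1)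
  have hK1 : 1 + K ≤ c₁ * L := by
    have h1 : Real.log Q ≤ L := Real.log_le_log hQ0 hQR
    have h2 : 1 ≤ 1 / Real.log 2 * L := by
      rw [one_div_mul_eq_div, one_le_div hl2]; exact hL
    have h3 : K ≤ 2 * b * L := by rw [hK]; gcongr
    rw [hc₁, add_mul]
    linarith
  have hexpK : Real.exp (1 / (2 * b) * K) = Q := by
    rw [hK, ← mul_assoc, one_div_mul_cancel (by positivity), one_mul, Real.exp_log hQ0]
  have hexpK' : Real.exp (-K) = d ^ (2 * b) * (R : ℝ) ^ (-(2 * b)) * L ^ (2 * b * p) := by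
    have h1 : Real.exp (-K) = Q ^ (-(2 * b)) := by
      rw [Real.rpow_def_of_pos hQ0, hK]; ring_nf
    rw [h1, hQ, Real.div_rpow hR0.le hdL0.le, Real.rpow_neg hdL0.le, div_inv_eq_mul,
      Real.mul_rpow hdpos.le (by positivity), ← Real.rpow_natCast, ← Real.rpow_mul hL0.le,
      mul_comm (p : ℝ)]
    ring
  -- Any index with `θ·a ≤ K` has `a i < J i`, so the collecting level `J i`, which is not finite
  -- dimensional in general, is never retained.
  set J : ι → ℕ := fun i => ⌊K / θ i⌋₊ + 1 with hJ
  set A : Finset (ι → ℕ) := (Fintype.piFinset fun i => Finset.range (J i)).filter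
    fun a => ∑ i, θ i * (a i : ℝ) ≤ K with hA
  refine ⟨J, A, fun a ha i => ?_, ?_, ?_⟩
  · exact Finset.mem_range.1 (Fintype.mem_piFinset.1 (Finset.mem_filter.1 ha).1 i)
  · have e : ∀ a : ι → ℕ, ∏ i, (c i * (2 : ℝ) ^ (a i * n i)) =
        (∏ i, c i) * Real.exp (∑ i, ν i * a i) := by
      intro a
      rw [Finset.prod_mul_distrib, Real.exp_sum]
      congr 1
      refine Finset.prod_congr rfl fun i _ => ?_
      rw [← Real.rpow_natCast, Real.rpow_def_of_pos (by norm_num)]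
      congr 1
      simp only [hνdef]
      push_cast
      ring
    simp only [e]
    rw [← Finset.mul_sum]
    have h1 := hhead K hK0 A fun a ha => (Finset.mem_filter.1 ha).2
    rw [hexpK] at h1
    calc (∏ i, c i) * ∑ a ∈ A, Real.exp (∑ i, ν i * a i)
        ≤ (∏ i, c i) * (Ch * Q * (c₁ * L) ^ p) := by
          gcongr
          exact h1.trans (by gcongr)
      _ = (2 * (∏ i, c i) * Ch * c₁ ^ p) * (R / 2 / d) := by
          rw [hQ, mul_pow]; field_simp
      _ ≤ d * (R / 2 / d) := by
          gcongr
          exact le_max_left _ _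
      _ = R / 2 := by field_simp
  · have e : ∀ a : ι → ℕ, ∏ i, (4 : ℝ) ^ (-(s i * (a i : ℝ))) =
        Real.exp (-∑ i, θ i * a i) := by
      intro a
      rw [← Finset.sum_neg_distrib, Real.exp_sum]
      refine Finset.prod_congr rfl fun i _ => ?_
      rw [Real.rpow_def_of_pos (by norm_num)]
      congr 1
      simp only [hθdef]
      ring
    simp only [e]
    refine (htail K hK0 _ fun a ha => ?_).trans ?_
    · rw [Finset.mem_sdiff] at ha
      by_contra hlt
      push Not at hlt
      refine ha.2 (Finset.mem_filter.2 ⟨Fintype.mem_piFinset.2 fun i => ?_, hlt.le⟩)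
      rw [Finset.mem_range, hJ, Nat.lt_succ_iff]
      refine Nat.le_floor ?_
      rw [le_div_iff₀ (hθ i), mul_comm]
      refine le_trans ?_ hlt.le
      exact Finset.single_le_sum (f := fun i => θ i * (a i : ℝ))
        (fun i _ => mul_nonneg (hθ i).le (Nat.cast_nonneg _)) (Finset.mem_univ i)
    · rw [hexpK', hk, Nat.add_sub_cancel, Real.rpow_add hL0, Real.rpow_natCast]
      calc Ct * (d ^ (2 * b) * (R : ℝ) ^ (-(2 * b)) * L ^ (2 * b * p)) * (1 + K) ^ k
          ≤ Ct * (d ^ (2 * b) * (R : ℝ) ^ (-(2 * b)) * L ^ (2 * b * p)) * (c₁ * L) ^ k := by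
            gcongr
        _ = (Ct * d ^ (2 * b) * c₁ ^ k) * (R : ℝ) ^ (-(2 * b)) *
              (L ^ k * L ^ (2 * b * p)) := by rw [mul_pow]; ring
        _ ≤ _ := by
            gcongr
            exact le_max_right _ _

/-! ### Images of algebraic tensors under tensor products of operators -/

section TensorImage

variable {m : ℕ} {n : Fin m → ℕ} {Ω : ∀ i, Set (EuclideanSpace ℝ (Fin (n i)))} {s : Fin m → ℝ}

/-- The image of an algebraic tensor under `D_1 ⊗ ⋯ ⊗ D_m`, as an element of `L²`. -/
noncomputable def tensorImage (D : ∀ i, L2 (Ω i) →ₗ[ℝ] L2 (Ω i)) (t : AlgTensor Ω s) :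
    Lp ℝ 2 (Measure.pi fun i => volume.restrict (Ω i)) :=
  ∑ p ∈ t.support, t p • piTensor (fun i => volume.restrict (Ω i)) fun i => D i (p i).1

theorem coeFn_tensorImage_id (t : AlgTensor Ω s) :
    tensorImage (fun _ => LinearMap.id) t =ᵐ[Measure.pi fun i => volume.restrict (Ω i)]
      t.toFun := by
  have h1 : ∀ᵐ x ∂(Measure.pi fun i => volume.restrict (Ω i)), ∀ p ∈ t.support,
      (t p • piTensor (fun i => volume.restrict (Ω i)) fun i => (p i).1 :
        Lp ℝ 2 (Measure.pi fun i => volume.restrict (Ω i))) x = t p * ∏ i, (p i).1 (x i) := by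
    refine (Finset.eventually_all _).2 fun p _ => ?_
    filter_upwards [Lp.coeFn_smul (t p)
      (piTensor (fun i => volume.restrict (Ω i)) fun i => (p i).1),
      coeFn_piTensor (fun i => volume.restrict (Ω i)) fun i => (p i).1] with x h1 h2
    rw [h1, Pi.smul_apply, h2, smul_eq_mul]
  filter_upwards [h1, Lp.coeFn_finsetSum t.support (fun p => (t p • piTensor
    (fun i => volume.restrict (Ω i)) fun i => (p i).1 :
      Lp ℝ 2 (Measure.pi fun i => volume.restrict (Ω i))))] with x h1 h2
  simp only [tensorImage, LinearMap.id_apply, AlgTensor.toFun, Finsupp.sum]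
  rw [h2, Finset.sum_apply]
  exact Finset.sum_congr rfl h1

theorem inner_tensorImage (D D' : ∀ i, L2 (Ω i) →ₗ[ℝ] L2 (Ω i)) (t : AlgTensor Ω s) :
    inner ℝ (tensorImage D t) (tensorImage D' t) = ∑ p ∈ t.support, ∑ q ∈ t.support,
      t p * t q * ∏ i, inner ℝ (D i (p i).1) (D' i (q i).1) := by
  simp only [tensorImage, sum_inner, inner_sum, real_inner_smul_left, real_inner_smul_right,
    inner_piTensor]
  rw [Finset.sum_comm]
  refine Finset.sum_congr rfl fun p _ => Finset.sum_congr rfl fun q _ => ?_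
  ring

theorem inner_tensorImage_eq_zero {D D' : ∀ i, L2 (Ω i) →ₗ[ℝ] L2 (Ω i)} (t : AlgTensor Ω s)
    {i : Fin m} (h : ∀ u v, inner ℝ (D i u) (D' i v) = 0) :
    inner ℝ (tensorImage D t) (tensorImage D' t) = 0 := by
  rw [inner_tensorImage]
  refine Finset.sum_eq_zero fun p _ => Finset.sum_eq_zero fun q _ => ?_
  rw [Finset.prod_eq_zero (Finset.mem_univ i) (h _ _), mul_zero]

theorem posSemidef_gram {n : ℕ} {Ω : Set (EuclideanSpace ℝ (Fin n))} {κ : Type*} [Fintype κ]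
    (D : L2 Ω →ₗ[ℝ] L2 Ω) (u : κ → L2 Ω) :
    (Matrix.of fun p q => inner ℝ (D (u p)) (D (u q))).PosSemidef := by
  refine posSemidef_of_form_nonneg (fun p q => real_inner_comm (D (u q)) (D (u p))) fun c => ?_
  have e : ∑ p, ∑ q, c p * c q * inner ℝ (D (u p)) (D (u q)) =
      inner ℝ (∑ p, c p • D (u p)) (∑ p, c p • D (u p)) := by
    simp only [sum_inner, inner_sum, real_inner_smul_left, real_inner_smul_right]
    rw [Finset.sum_comm]
    refine Finset.sum_congr rfl fun p _ => Finset.sum_congr rfl fun q _ => ?_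
    ring
  simp only [Matrix.of_apply]
  rw [e]
  exact real_inner_self_nonneg

theorem posSemidef_sobolev_sub_gram {n : ℕ} {Ω : Set (EuclideanSpace ℝ (Fin n))} (hΩ : IsOpen Ω)
    {s w : ℝ} {κ : Type*} [Fintype κ] (D : L2 Ω →ₗ[ℝ] L2 Ω)
    (hD : ∀ u, MemSobolev Ω s u → ‖D u‖ ^ 2 ≤ w * sobolevInner Ω s u u)
    (u : κ → SobolevSpace Ω s) :
    ((Matrix.of fun p q => w * sobolevInner Ω s (u p).1 (u q).1) -
      Matrix.of fun p q => inner ℝ (D (u p).1) (D (u q).1)).PosSemidef := by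
  refine posSemidef_of_form_nonneg (fun p q => ?_) fun c => ?_
  · simp only [Matrix.sub_apply, Matrix.of_apply]
    rw [sobolevInner_comm, real_inner_comm]
  let u' : κ → sobolevSubmodule Ω hΩ s := fun p => ⟨(u p).1, (u p).2⟩
  let U : sobolevSubmodule Ω hΩ s := ∑ p, c p • u' p
  have e1 : sobolevInner Ω s U U = ∑ p, ∑ q, c p * c q * sobolevInner Ω s (u p).1 (u q).1 := by
    change sobolevForm Ω hΩ s U U = _
    simp only [U, map_sum, map_smul, LinearMap.sum_apply, LinearMap.smul_apply, smul_eq_mul,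
      Finset.mul_sum]
    rw [Finset.sum_comm]
    refine Finset.sum_congr rfl fun p _ => Finset.sum_congr rfl fun q _ => ?_
    change c q * (c p * sobolevInner Ω s (u p).1 (u q).1) = _
    ring
  have hU : (U : L2 Ω) = ∑ p, c p • (u p).1 := by
    simp [U, u']
  have e2 : ‖D U‖ ^ 2 = ∑ p, ∑ q, c p * c q * inner ℝ (D (u p).1) (D (u q).1) := by
    rw [← real_inner_self_eq_norm_sq, hU]
    simp only [map_sum, map_smul, sum_inner, inner_sum, real_inner_smul_left,
      real_inner_smul_right]
    rw [Finset.sum_comm]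
    refine Finset.sum_congr rfl fun p _ => Finset.sum_congr rfl fun q _ => ?_
    ring
  have h := hD U U.2
  rw [e1, e2, Finset.mul_sum] at h
  refine (sub_nonneg.2 h).trans_eq ?_
  rw [← Finset.sum_sub_distrib]
  refine Finset.sum_congr rfl fun p _ => ?_
  rw [Finset.mul_sum, ← Finset.sum_sub_distrib]
  refine Finset.sum_congr rfl fun q _ => ?_
  simp only [Matrix.sub_apply, Matrix.of_apply]
  ring

/-- Both sides are quadratic forms in the coefficients of `t`, whose matrices are Hadamard products
of the Gram matrices of the single factors. The hypothesis orders these factor by factor. -/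
theorem norm_sq_tensorImage_le_form (hΩ : ∀ i, IsOpen (Ω i))
    {D : ∀ i, L2 (Ω i) →ₗ[ℝ] L2 (Ω i)} {w : Fin m → ℝ}
    (hD : ∀ i u, MemSobolev (Ω i) (s i) u → ‖D i u‖ ^ 2 ≤ w i * sobolevInner (Ω i) (s i) u u)
    (t : AlgTensor Ω s) :
    ‖tensorImage D t‖ ^ 2 ≤ (∏ i, w i) * t.sum fun u c => t.sum fun v d =>
      c * d * ∏ i, sobolevInner (Ω i) (s i) (u i).1 (v i).1 := by
  have hG : ∀ i, (Matrix.of fun p q : t.support =>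
      inner ℝ (D i (p.1 i).1) (D i (q.1 i).1)).PosSemidef :=
    fun i => posSemidef_gram (D i) fun p : t.support => (p.1 i).1
  have hGH := fun i => posSemidef_sobolev_sub_gram (hΩ i) (D i) (hD i) fun p : t.support => p.1 i
  have h := form_prod_le_form_prod hG hGH fun p => t p.1
  rw [← real_inner_self_eq_norm_sq, inner_tensorImage]
  simp only [Matrix.of_apply, Finset.prod_mul_distrib] at h
  simp only [Finsupp.sum, Finset.mul_sum]
  rw [← Finset.sum_coe_sort t.support, ← Finset.sum_coe_sort t.support]
  simp only [← Finset.sum_coe_sort t.support]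
  refine h.trans_eq ?_
  refine Finset.sum_congr rfl fun p _ => Finset.sum_congr rfl fun q _ => ?_
  ring

theorem norm_sq_tensorImage_le (hΩ : ∀ i, IsOpen (Ω i))
    {D : ∀ i, L2 (Ω i) →ₗ[ℝ] L2 (Ω i)} {w : Fin m → ℝ}
    (hD : ∀ i u, MemSobolev (Ω i) (s i) u → ‖D i u‖ ^ 2 ≤ w i * sobolevInner (Ω i) (s i) u u)
    (t : AlgTensor Ω s) :
    ‖tensorImage D t‖ ^ 2 ≤ (∏ i, w i) * t.crossNorm ^ 2 := by
  -- The case of identities shows that the form under the root in `crossNorm` is nonnegative, so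
  -- that squaring undoes `Real.sqrt`.
  have h0 := norm_sq_tensorImage_le_form hΩ (D := fun _ => LinearMap.id) (w := fun _ => 1)
    (fun i u _ => by simpa using norm_sq_le_sobolevInner (hΩ i) (s i) u) t
  rw [Finset.prod_const_one, one_mul] at h0
  rw [AlgTensor.crossNorm, Real.sq_sqrt ((sq_nonneg _).trans h0)]
  exact norm_sq_tensorImage_le_form hΩ hD t

theorem norm_tensorImage_id_le (hΩ : ∀ i, IsOpen (Ω i)) (t : AlgTensor Ω s) :
    ‖tensorImage (fun _ => LinearMap.id) t‖ ≤ t.crossNorm := by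
  have h := norm_sq_tensorImage_le hΩ (D := fun _ => LinearMap.id) (w := fun _ => 1)
    (fun i u _ => by simpa using norm_sq_le_sobolevInner (hΩ i) (s i) u) t
  rw [Finset.prod_const_one, one_mul] at h
  exact le_of_sq_le_sq h (Real.sqrt_nonneg _)

theorem tensorImage_id_eq_sum {D : ∀ i, ℕ → L2 (Ω i) →ₗ[ℝ] L2 (Ω i)} {J : Fin m → ℕ}
    (hD : ∀ i u, ∑ j ∈ Finset.range (J i + 1), D i j u = u) (t : AlgTensor Ω s) :
    tensorImage (fun _ => LinearMap.id) t =
      ∑ a ∈ Fintype.piFinset fun i => Finset.range (J i + 1), tensorImage (fun i => D i (a i)) t := by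
  simp only [tensorImage, LinearMap.id_apply]
  rw [Finset.sum_comm]
  refine Finset.sum_congr rfl fun p _ => ?_
  rw [← Finset.smul_sum]
  congr 1
  conv_lhs => rw [show (fun i => (p i).1) = fun i =>
    ∑ j ∈ Finset.range (J i + 1), D i j (p i).1 from funext fun i => (hD i _).symm]
  rw [MultilinearMap.map_sum_finset]

/-- Blocks of different multi-indices are orthogonal, because inner products factorise and one
factor in which the indices differ already vanishes. -/
theorem norm_sq_sum_tensorImage_le (hΩ : ∀ i, IsOpen (Ω i))
    {D : ∀ i, ℕ → L2 (Ω i) →ₗ[ℝ] L2 (Ω i)} {w : Fin m → ℕ → ℝ}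
    (hortho : ∀ i j k, j ≠ k → ∀ u v, inner ℝ (D i j u) (D i k v) = 0) (t : AlgTensor Ω s)
    (S : Finset (Fin m → ℕ))
    (hD : ∀ a ∈ S, ∀ i u, MemSobolev (Ω i) (s i) u →
      ‖D i (a i) u‖ ^ 2 ≤ w i (a i) * sobolevInner (Ω i) (s i) u u) :
    ‖∑ a ∈ S, tensorImage (fun i => D i (a i)) t‖ ^ 2 ≤
      (∑ a ∈ S, ∏ i, w i (a i)) * t.crossNorm ^ 2 := by
  rw [← real_inner_self_eq_norm_sq, sum_inner, Finset.sum_mul]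
  refine Finset.sum_le_sum fun a ha => ?_
  rw [inner_sum, Finset.sum_eq_single_of_mem a ha, real_inner_self_eq_norm_sq]
  · exact norm_sq_tensorImage_le hΩ (hD a ha) t
  · intro b _ hb
    obtain ⟨i, hi⟩ := Function.ne_iff.1 hb
    exact inner_tensorImage_eq_zero t (hortho i _ _ (Ne.symm hi))

end TensorImage

/-! ### Separability of the retained part -/

section Retained

variable {m : ℕ} {n : Fin m → ℕ} {Ω : ∀ i, Set (EuclideanSpace ℝ (Fin (n i)))} {s : Fin m → ℝ}
  {p q : Fin m → Prop} [DecidablePred p] [DecidablePred q]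

theorem tensorImage_eq_sum_splitTensor (hpq : ∀ i, q i ↔ ¬ p i)
    (D : ∀ i, L2 (Ω i) →ₗ[ℝ] L2 (Ω i)) (t : AlgTensor Ω s) :
    tensorImage D t = ∑ u ∈ t.support,
      splitTensor (fun i => volume.restrict (Ω i)) hpq
        (t u • piTensor (fun i : {i // p i} => volume.restrict (Ω i)) fun i => D i (u i).1)
        (piTensor (fun i : {i // q i} => volume.restrict (Ω i)) fun i => D i (u i).1) := by
  refine Finset.sum_congr rfl fun u _ => ?_
  rw [piTensor_eq_splitTensor (fun i => volume.restrict (Ω i)) hpq, map_smul,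
    LinearMap.smul_apply]

/-- Blocks are grouped by their restriction `α` to the first variables. Within a group all left
factors lie in one space of dimension at most `∏ dim V_{α_i}`, so neither the levels on the right
nor the length of `t` affect the count. -/
theorem isSeparableSum_left (hpq : ∀ i, q i ↔ ¬ p i) {V : ∀ i, ℕ → Submodule ℝ (L2 (Ω i))}
    (hV : ∀ i j, FiniteDimensional ℝ (V i j)) {D : ∀ i, ℕ → L2 (Ω i) →ₗ[ℝ] L2 (Ω i)}
    (t : AlgTensor Ω s) (U : Finset (Fin m → ℕ)) (A : Finset ({i // p i} → ℕ))
    (hA : ∀ a ∈ U, (fun i : {i // p i} => a i) ∈ A)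
    (hD : ∀ a ∈ U, ∀ i : {i // p i}, ∀ u, D i (a i) u ∈ V i (a i)) :
    IsSeparableSum (splitTensor (fun i => volume.restrict (Ω i)) hpq)
      (∑ α ∈ A, ∏ i : {i // p i}, Module.finrank ℝ (V i (α i)))
      (∑ a ∈ U, tensorImage (fun i => D i (a i)) t) := by
  rw [← Finset.sum_fiberwise_of_maps_to hA]
  refine IsSeparableSum.sum A fun α _ => ?_
  obtain ⟨F, hF, hFd, hFm⟩ := exists_finiteDimensional_multilinear_mem
    (piTensor (fun i : {i // p i} => volume.restrict (Ω i))) fun i : {i // p i} => V i (α i)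
  refine IsSeparableSum.mono hFd ?_
  simp only [tensorImage_eq_sum_splitTensor hpq]
  rw [← Finset.sum_product']
  refine IsSeparableSum.of_left_mem _ (x := fun z : (Fin m → ℕ) × _ => t z.2 •
    piTensor (fun i : {i // p i} => volume.restrict (Ω i)) fun i => D i (z.1 i) (z.2 i).1)
    (y := fun z : (Fin m → ℕ) × _ =>
    piTensor (fun i : {i // q i} => volume.restrict (Ω i)) fun i => D i (z.1 i) (z.2 i).1)
    F fun z hz => ?_
  obtain ⟨hz1, -⟩ := Finset.mem_product.1 hz
  obtain ⟨hz1, hz2⟩ := Finset.mem_filter.1 hz1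
  refine F.smul_mem _ (hFm _ fun i => ?_)
  rw [← hz2]
  exact hD _ hz1 i _

theorem isSeparableSum_right (hpq : ∀ i, q i ↔ ¬ p i) {V : ∀ i, ℕ → Submodule ℝ (L2 (Ω i))}
    (hV : ∀ i j, FiniteDimensional ℝ (V i j)) {D : ∀ i, ℕ → L2 (Ω i) →ₗ[ℝ] L2 (Ω i)}
    (t : AlgTensor Ω s) (U : Finset (Fin m → ℕ)) (A : Finset ({i // q i} → ℕ))
    (hA : ∀ a ∈ U, (fun i : {i // q i} => a i) ∈ A)
    (hD : ∀ a ∈ U, ∀ i : {i // q i}, ∀ u, D i (a i) u ∈ V i (a i)) :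
    IsSeparableSum (splitTensor (fun i => volume.restrict (Ω i)) hpq)
      (∑ α ∈ A, ∏ i : {i // q i}, Module.finrank ℝ (V i (α i)))
      (∑ a ∈ U, tensorImage (fun i => D i (a i)) t) := by
  rw [← Finset.sum_fiberwise_of_maps_to hA]
  refine IsSeparableSum.sum A fun α _ => ?_
  obtain ⟨F, hF, hFd, hFm⟩ := exists_finiteDimensional_multilinear_mem
    (piTensor (fun i : {i // q i} => volume.restrict (Ω i))) fun i : {i // q i} => V i (α i)
  refine IsSeparableSum.mono hFd ?_
  simp only [tensorImage_eq_sum_splitTensor hpq]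
  rw [← Finset.sum_product']
  refine IsSeparableSum.of_right_mem _ (x := fun z : (Fin m → ℕ) × _ => t z.2 •
    piTensor (fun i : {i // p i} => volume.restrict (Ω i)) fun i => D i (z.1 i) (z.2 i).1) (y := fun z : (Fin m → ℕ) × _ =>
    piTensor (fun i : {i // q i} => volume.restrict (Ω i)) fun i => D i (z.1 i) (z.2 i).1)
    F fun z hz => ?_
  obtain ⟨hz1, -⟩ := Finset.mem_product.1 hz
  obtain ⟨hz1, hz2⟩ := Finset.mem_filter.1 hz1
  refine hFm _ fun i => ?_
  rw [← hz2]
  exact hD _ hz1 i _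

theorem prod_eq_prod_subtype_mul {ι : Type*} [Fintype ι] {p q : ι → Prop} [DecidablePred p]
    [DecidablePred q] (hpq : ∀ i, q i ↔ ¬ p i) (f : ι → ℝ) :
    ∏ i, f i = (∏ i : {i // p i}, f i) * ∏ i : {i // q i}, f i := by
  obtain rfl : q = fun i => ¬ p i := funext fun i => propext (hpq i)
  rw [← Fintype.prod_subtype_mul_prod_subtype p f]
  congr!

/-- A multi-index is determined by its two restrictions, so the left side is part of the expanded
product of nonnegative sums. -/
theorem sum_prod_le_mul_sum_prod {ι : Type*} [Fintype ι] [DecidableEq ι] {p q : ι → Prop}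
    [DecidablePred p] [DecidablePred q] (hpq : ∀ i, q i ↔ ¬ p i) {w : ι → ℕ → ℝ}
    (hw : ∀ i j, 0 ≤ w i j) (S : Finset (ι → ℕ)) (G₁ : Finset ({i // p i} → ℕ))
    (G₂ : Finset ({i // q i} → ℕ)) (h₁ : ∀ a ∈ S, (fun i : {i // p i} => a i) ∈ G₁)
    (h₂ : ∀ a ∈ S, (fun i : {i // q i} => a i) ∈ G₂) :
    ∑ a ∈ S, ∏ i, w i (a i) ≤
      (∑ α ∈ G₁, ∏ i : {i // p i}, w i (α i)) * ∑ α ∈ G₂, ∏ i : {i // q i}, w i (α i) := by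
  have hinj : Set.InjOn (fun a : ι → ℕ =>
      ((fun i : {i // p i} => a i), (fun i : {i // q i} => a i))) S := by
    intro a _ b _ hab
    simp only [Prod.mk.injEq] at hab
    ext i
    by_cases hi : p i
    · exact congrFun hab.1 ⟨i, hi⟩
    · exact congrFun hab.2 ⟨i, (hpq i).2 hi⟩
  rw [Finset.sum_mul_sum, ← Finset.sum_product']
  simp only [prod_eq_prod_subtype_mul hpq]
  rw [← Finset.sum_image (f := fun z : ({i // p i} → ℕ) × ({i // q i} → ℕ) =>
    (∏ i : {i // p i}, w i (z.1 i)) * ∏ i : {i // q i}, w i (z.2 i)) hinj]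
  refine Finset.sum_le_sum_of_subset_of_nonneg (fun z hz => ?_) fun z _ _ =>
    mul_nonneg (Finset.prod_nonneg fun i _ => hw _ _) (Finset.prod_nonneg fun i _ => hw _ _)
  obtain ⟨a, ha, rfl⟩ := Finset.mem_image.1 hz
  exact Finset.mem_product.2 ⟨h₁ a ha, h₂ a ha⟩

end Retained

/-! ### Low-rank approximation of algebraic tensors -/

theorem card_subtype_add_card_subtype {ι : Type*} [Fintype ι] {p q : ι → Prop} [DecidablePred p]
    [DecidablePred q] (hpq : ∀ i, q i ↔ ¬ p i) :
    Fintype.card {i // p i} + Fintype.card {i // q i} = Fintype.card ι := by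
  rw [Fintype.card_subtype, Fintype.card_subtype]
  simp only [hpq]
  rw [Finset.card_filter_add_card_filter_not, Finset.card_univ]

theorem last_iff_not_first {m ℓ : ℕ} (i : Fin m) : ℓ ≤ (i : ℕ) ↔ ¬ ((i : ℕ) < ℓ) := not_lt.symm

theorem log_rpow_le_of_le {R : ℕ} (hR : 2 ≤ R) {e e' : ℝ} (h : e ≤ e') :
    Real.log R ^ e ≤ Real.log 2 ^ (e - e') * Real.log R ^ e' := by
  have hl2 : 0 < Real.log 2 := Real.log_pos (by norm_num)
  have hL : Real.log 2 ≤ Real.log R := Real.log_le_log (by norm_num) (by exact_mod_cast hR)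
  have hL0 : 0 < Real.log R := hl2.trans_le hL
  calc Real.log R ^ e = Real.log R ^ (e - e') * Real.log R ^ e' := by
        rw [← Real.rpow_add hL0, sub_add_cancel]
    _ ≤ _ := mul_le_mul_of_nonneg_right
        (Real.rpow_le_rpow_of_nonpos hl2 hL (sub_nonpos.2 h)) (Real.rpow_nonneg hL0.le _)

/-- The two tails contribute `k₁ - 1 + k₂ - 1 = m - 2`, one less than is allowed. -/
theorem rate_exponent_le {k₁ k₂ m b₁ b₂ P₁ P₂ : ℝ} (hk : k₁ + k₂ = m) (hb₁ : 0 ≤ b₁)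
    (hb₂ : 0 ≤ b₂) : (k₁ - 1 + 2 * b₁ * (P₁ - 1)) + (k₂ - 1 + 2 * b₂ * (P₂ - 1)) ≤
      2 * ((m - 1) / 2 + (b₁ + b₂) * (max P₁ P₂ - 1)) := by
  have h1 := mul_le_mul_of_nonneg_left (le_max_left P₁ P₂) hb₁
  have h2 := mul_le_mul_of_nonneg_left (le_max_right P₁ P₂) hb₂
  linarith

theorem sum_prod_finrank_le {κ : Type*} [Fintype κ] {E : κ → Type*} [∀ i, AddCommGroup (E i)]
    [∀ i, Module ℝ (E i)] {V : ∀ i, ℕ → Submodule ℝ (E i)} {n : κ → ℕ} {c : κ → ℝ}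
    (hV : ∀ i j, (Module.finrank ℝ (V i j) : ℝ) ≤ c i * 2 ^ (j * n i)) (A : Finset (κ → ℕ)) :
    ((∑ α ∈ A, ∏ i, Module.finrank ℝ (V i (α i)) : ℕ) : ℝ) ≤
      ∑ α ∈ A, ∏ i, (c i * (2 : ℝ) ^ (α i * n i)) := by
  push_cast
  exact Finset.sum_le_sum fun α _ =>
    Finset.prod_le_prod (fun i _ => Nat.cast_nonneg _) fun i _ => hV i _

theorem exists_isSeparableSum_approx {m : ℕ} {ℓ : ℕ} (hℓ : 1 ≤ ℓ) (hℓm : ℓ < m)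
    {n : Fin m → ℕ} (hn : ∀ i, 1 ≤ n i) {Ω : ∀ i, Set (EuclideanSpace ℝ (Fin (n i)))}
    (hΩ : ∀ i, IsOpen (Ω i)) {r : Fin m → ℕ} {V : ∀ i, ℕ → Submodule ℝ (L2 (Ω i))}
    (hV : ∀ i, IsMultiscaleHierarchy (Ω i) (r i) (V i))
    {s : Fin m → ℝ} (hs : ∀ i, 0 ≤ s i) (hsr : ∀ i, s i ≤ r i) {β : ℝ}
    (hβ : β = (⨅ i : FirstIdx m ℓ, s i / n i) + ⨅ i : LastIdx m ℓ, s i / n i) {P₁ P₂ : ℕ}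
    (hP₁ : P₁ = minCount fun i : FirstIdx m ℓ => s i / n i)
    (hP₂ : P₂ = minCount fun i : LastIdx m ℓ => s i / n i) :
    ∃ C > (0 : ℝ), ∀ (t : AlgTensor Ω s) (R : ℕ), 2 ≤ R →
      ∃ Z, IsSeparableSum
          (splitTensor (fun i => volume.restrict (Ω i)) (last_iff_not_first (ℓ := ℓ))) R Z ∧
        ‖tensorImage (fun _ => LinearMap.id) t - Z‖ ≤ C * (R : ℝ) ^ (-β) *
          Real.log R ^ (((m : ℝ) - 1) / 2 + β * (max (P₁ : ℝ) P₂ - 1)) * t.crossNorm := by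
  have : Nonempty (FirstIdx m ℓ) := ⟨⟨⟨0, by omega⟩, by simp; omega⟩⟩
  have : Nonempty (LastIdx m ℓ) := ⟨⟨⟨ℓ, hℓm⟩, le_rfl⟩⟩
  have hpq : ∀ i : Fin m, ℓ ≤ (i : ℕ) ↔ ¬ ((i : ℕ) < ℓ) := last_iff_not_first
  choose Cl hCl hlev using fun i => (hV i).exists_levels (hΩ i) (hs i) (hsr i)
  choose c hc cd hcd hdim using fun i => (hV i).dim_equiv
  set b₁ : ℝ := ⨅ i : FirstIdx m ℓ, s i / n i with hb₁
  set b₂ : ℝ := ⨅ i : LastIdx m ℓ, s i / n i with hb₂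
  have hb₁0 : 0 ≤ b₁ := Real.iInf_nonneg fun i => div_nonneg (hs _) (Nat.cast_nonneg _)
  have hb₂0 : 0 ≤ b₂ := Real.iInf_nonneg fun i => div_nonneg (hs _) (Nat.cast_nonneg _)
  obtain ⟨C₁, hC₁, hset₁⟩ := exists_index_set (ι := FirstIdx m ℓ) (fun i => hn i) (fun i => hs i)
    (fun i => hcd i) hb₁ hP₁
  obtain ⟨C₂, hC₂, hset₂⟩ := exists_index_set (ι := LastIdx m ℓ) (fun i => hn i) (fun i => hs i)
    (fun i => hcd i) hb₂ hP₂
  set γ : ℝ := ((m : ℝ) - 1) / 2 + β * (max (P₁ : ℝ) P₂ - 1) with hγ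
  set e₁ : ℝ := (Fintype.card (FirstIdx m ℓ) : ℝ) - 1 + 2 * b₁ * ((P₁ : ℝ) - 1)
  set e₂ : ℝ := (Fintype.card (LastIdx m ℓ) : ℝ) - 1 + 2 * b₂ * ((P₂ : ℝ) - 1)
  have he : e₁ + e₂ ≤ 2 * γ := by
    rw [hγ, hβ]
    refine rate_exponent_le ?_ hb₁0 hb₂0
    have := card_subtype_add_card_subtype hpq
    rw [Fintype.card_fin] at this
    exact_mod_cast this
  have hl2 : 0 < Real.log 2 := Real.log_pos (by norm_num)
  have hClpos : 0 < ∏ i, Cl i := Finset.prod_pos fun i _ => hCl i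
  -- The constant of the squared error. The power of `log 2` pays for raising the exponent of `log
  -- R`, which is below `1` for `R = 2`.
  set B : ℝ := (∏ i, Cl i) * (C₁ * C₂) * Real.log 2 ^ (e₁ + e₂ - 2 * γ) with hB
  have hBpos : 0 < B := by positivity
  refine ⟨Real.sqrt B, Real.sqrt_pos.2 hBpos, fun t R hR => ?_⟩
  have hR0 : (0 : ℝ) < R := by positivity
  have hL0 : 0 < Real.log R := Real.log_pos (by exact_mod_cast hR)
  obtain ⟨J₁, A₁, hA₁, hcard₁, hsum₁⟩ := hset₁ R hR
  obtain ⟨J₂, A₂, hA₂, hcard₂, hsum₂⟩ := hset₂ R hR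
  set J : Fin m → ℕ := fun i => if h : (i : ℕ) < ℓ then J₁ ⟨i, h⟩ else J₂ ⟨i, not_lt.1 h⟩ with hJ
  have hJ₁ : ∀ i : FirstIdx m ℓ, J i = J₁ i := fun i => by simp [hJ, i.2]
  have hJ₂ : ∀ i : LastIdx m ℓ, J i = J₂ i := fun i => by simp [hJ, not_lt.2 i.2]
  choose D hDsum hDmem hDortho hDnorm using fun i => hlev i (J i)
  set grid := Fintype.piFinset fun i => Finset.range (J i + 1) with hgrid
  have hgrid₁ : ∀ a ∈ grid, (fun i : FirstIdx m ℓ => a i) ∈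
      Fintype.piFinset fun i => Finset.range (J₁ i + 1) := fun a ha =>
    Fintype.mem_piFinset.2 fun i => hJ₁ i ▸ Fintype.mem_piFinset.1 ha i
  have hgrid₂ : ∀ a ∈ grid, (fun i : LastIdx m ℓ => a i) ∈
      Fintype.piFinset fun i => Finset.range (J₂ i + 1) := fun a ha =>
    Fintype.mem_piFinset.2 fun i => hJ₂ i ▸ Fintype.mem_piFinset.1 ha i
  -- Kept are `U₁` (first half in `A₁`) and `U₂` (only the second half in its set); `S`, with both
  -- halves outside, is the error.
  set U₁ := grid.filter fun a => (fun i : FirstIdx m ℓ => a i) ∈ A₁ with hU₁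
  set W := grid.filter fun a => ¬ (fun i : FirstIdx m ℓ => a i) ∈ A₁ with hW
  set U₂ := W.filter fun a => (fun i : LastIdx m ℓ => a i) ∈ A₂ with hU₂
  set S := W.filter fun a => ¬ (fun i : LastIdx m ℓ => a i) ∈ A₂ with hS
  set X : (Fin m → ℕ) → _ := fun a => tensorImage (fun i => D i (a i)) t with hX
  have hT : tensorImage (fun _ => LinearMap.id) t =
      (∑ a ∈ U₁, X a + ∑ a ∈ U₂, X a) + ∑ a ∈ S, X a := by
    rw [tensorImage_id_eq_sum hDsum t, add_assoc, hU₂, hS, Finset.sum_filter_add_sum_filter_not,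
      hU₁, hW, Finset.sum_filter_add_sum_filter_not]
  have hsep₁ := isSeparableSum_left hpq (fun i j => (hV i).finiteDimensional j) (D := D) t U₁ A₁
    (fun a ha => (Finset.mem_filter.1 ha).2) (fun a ha i u => hDmem i _ (by
      rw [hJ₁]; exact hA₁ _ (Finset.mem_filter.1 ha).2 i) u)
  have hsep₂ := isSeparableSum_right hpq (fun i j => (hV i).finiteDimensional j) (D := D) t U₂ A₂
    (fun a ha => (Finset.mem_filter.1 ha).2) (fun a ha i u => hDmem i _ (by
      rw [hJ₂]; exact hA₂ _ (Finset.mem_filter.1 ha).2 i) u)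
  refine ⟨∑ a ∈ U₁, X a + ∑ a ∈ U₂, X a, (hsep₁.add hsep₂).mono ?_, ?_⟩
  · have h1 := (sum_prod_finrank_le (V := fun i : FirstIdx m ℓ => V i) (n := fun i => n i)
      (fun i j => (hdim i j).2) A₁).trans hcard₁
    have h2 := (sum_prod_finrank_le (V := fun i : LastIdx m ℓ => V i) (n := fun i => n i)
      (fun i j => (hdim i j).2) A₂).trans hcard₂
    have h3 := add_le_add h1 h2
    rw [add_halves] at h3
    exact_mod_cast h3
  rw [hT, add_sub_cancel_left]
  have hSgrid : ∀ a ∈ S, a ∈ grid := fun a ha =>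
    (Finset.mem_filter.1 (Finset.mem_filter.1 ha).1).1
  have hnorm := norm_sq_sum_tensorImage_le hΩ (D := D)
    (w := fun i j => Cl i * (4 : ℝ) ^ (-(s i * (j : ℝ)))) hDortho t S
    (fun a ha i u hu => hDnorm i _ (Nat.lt_succ_iff.1 (Finset.mem_range.1
      (Fintype.mem_piFinset.1 (hSgrid a ha) i))) u hu)
  simp only [Finset.prod_mul_distrib] at hnorm
  rw [← Finset.mul_sum] at hnorm
  have hsum := sum_prod_le_mul_sum_prod hpq (w := fun i j => (4 : ℝ) ^ (-(s i * (j : ℝ))))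
    (fun i j => by positivity) S
    ((Fintype.piFinset fun i : FirstIdx m ℓ => Finset.range (J₁ i + 1)) \ A₁)
    ((Fintype.piFinset fun i : LastIdx m ℓ => Finset.range (J₂ i + 1)) \ A₂)
    (fun a ha => Finset.mem_sdiff.2 ⟨hgrid₁ a (hSgrid a ha),
      (Finset.mem_filter.1 (Finset.mem_filter.1 ha).1).2⟩)
    (fun a ha => Finset.mem_sdiff.2 ⟨hgrid₂ a (hSgrid a ha), (Finset.mem_filter.1 ha).2⟩)
  have hsum' := hsum.trans (mul_le_mul hsum₁ hsum₂
    (Finset.sum_nonneg fun a _ => Finset.prod_nonneg fun i _ => by positivity) (by positivity))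
  have hcn : 0 ≤ t.crossNorm := Real.sqrt_nonneg _
  refine le_of_sq_le_sq (hnorm.trans ?_) (by positivity)
  calc (∏ i, Cl i) * (∑ a ∈ S, ∏ i, (4 : ℝ) ^ (-(s i * (a i : ℝ)))) * t.crossNorm ^ 2
      ≤ (∏ i, Cl i) * ((C₁ * (R : ℝ) ^ (-(2 * b₁)) * Real.log R ^ e₁) *
          (C₂ * (R : ℝ) ^ (-(2 * b₂)) * Real.log R ^ e₂)) * t.crossNorm ^ 2 := by gcongr
    _ = (∏ i, Cl i) * (C₁ * C₂) * ((R : ℝ) ^ (-β)) ^ 2 * Real.log R ^ (e₁ + e₂) *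
          t.crossNorm ^ 2 := by
        have h1 : ((R : ℝ) ^ (-β)) ^ 2 = (R : ℝ) ^ (-(2 * b₁)) * (R : ℝ) ^ (-(2 * b₂)) := by
          rw [← Real.rpow_natCast, ← Real.rpow_mul hR0.le, ← Real.rpow_add hR0, hβ]
          congr 1
          push_cast
          ring
        rw [h1, Real.rpow_add hL0 e₁ e₂]
        ring
    _ ≤ (∏ i, Cl i) * (C₁ * C₂) * ((R : ℝ) ^ (-β)) ^ 2 *
          (Real.log 2 ^ (e₁ + e₂ - 2 * γ) * Real.log R ^ (2 * γ)) * t.crossNorm ^ 2 := by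
        gcongr
        exact log_rpow_le_of_le hR he
    _ = (Real.sqrt B * (R : ℝ) ^ (-β) * Real.log R ^ γ * t.crossNorm) ^ 2 := by
        have h2 : (Real.log R ^ γ) ^ 2 = Real.log R ^ (2 * γ) := by
          rw [← Real.rpow_natCast, ← Real.rpow_mul hL0.le]
          congr 1
          push_cast
          ring
        rw [mul_pow, mul_pow, mul_pow, Real.sq_sqrt hBpos.le, h2, hB]
        ring

/-! ### Passage to the completion -/

theorem exists_functions_of_isSeparableSum {m ℓ : ℕ} {n : Fin m → ℕ}
    {Ω : ∀ i, Set (EuclideanSpace ℝ (Fin (n i)))} {R : ℕ}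
    {Z : Lp ℝ 2 (Measure.pi fun i => volume.restrict (Ω i))}
    (hZ : IsSeparableSum
      (splitTensor (fun i => volume.restrict (Ω i)) (last_iff_not_first (ℓ := ℓ))) R Z) :
    ∃ (g₁ : Fin R → (∀ i : FirstIdx m ℓ, EuclideanSpace ℝ (Fin (n i))) → ℝ)
      (g₂ : Fin R → (∀ i : LastIdx m ℓ, EuclideanSpace ℝ (Fin (n i))) → ℝ),
      (∀ ρ, MemLp (g₁ ρ) 2 (Measure.pi fun i : FirstIdx m ℓ => volume.restrict (Ω i))) ∧
      (∀ ρ, MemLp (g₂ ρ) 2 (Measure.pi fun i : LastIdx m ℓ => volume.restrict (Ω i))) ∧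
      Z =ᵐ[Measure.pi fun i => volume.restrict (Ω i)] separableSum g₁ g₂ := by
  obtain ⟨e, y, rfl⟩ := hZ
  refine ⟨fun ρ => e ρ, fun ρ => y ρ, fun ρ => Lp.memLp _, fun ρ => Lp.memLp _, ?_⟩
  have h : ∀ᵐ x ∂(Measure.pi fun i => volume.restrict (Ω i)), ∀ ρ,
      splitTensor (fun i => volume.restrict (Ω i)) (last_iff_not_first (ℓ := ℓ)) (e ρ) (y ρ) x =
        e ρ (fun i => x i) * y ρ (fun i => x i) :=
    ae_all_iff.2 fun ρ => coeFn_splitTensor _ _ _ _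
  filter_upwards [h, Lp.coeFn_finsetSum Finset.univ fun ρ =>
    splitTensor (fun i => volume.restrict (Ω i)) (last_iff_not_first (ℓ := ℓ)) (e ρ) (y ρ)]
    with x h1 h2
  rw [h2, Finset.sum_apply]
  exact Finset.sum_congr rfl fun ρ _ => h1 ρ

theorem HasMixedNorm.exists_approx {m : ℕ} {n : Fin m → ℕ}
    {Ω : ∀ i, Set (EuclideanSpace ℝ (Fin (n i)))} {s : Fin m → ℝ}
    {F : Lp ℝ 2 (Measure.pi fun i => volume.restrict (Ω i))}
    {f : (∀ i, EuclideanSpace ℝ (Fin (n i))) → ℝ} {N : ℝ} (h : HasMixedNorm Ω s f N)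
    (hF : F =ᵐ[Measure.pi fun i => volume.restrict (Ω i)] f) {ε : ℝ} (hε : 0 < ε) :
    ∃ t : AlgTensor Ω s, t.crossNorm < N + ε ∧
      ‖F - tensorImage (fun _ => LinearMap.id) t‖ < ε := by
  obtain ⟨t, -, h1, h2⟩ := h
  have h3 : Tendsto (fun k => ‖F - tensorImage (fun _ => LinearMap.id) (t k)‖) atTop (𝓝 0) := by
    have h4 := (ENNReal.tendsto_toReal ENNReal.zero_ne_top).comp h2
    rw [ENNReal.toReal_zero] at h4
    refine h4.congr fun k => ?_
    rw [Lp.norm_def, Function.comp_apply]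
    congr 1
    refine eLpNorm_congr_ae ?_
    filter_upwards [hF, coeFn_tensorImage_id (t k),
      Lp.coeFn_sub F (tensorImage (fun _ => LinearMap.id) (t k))] with x e1 e2 e3
    rw [e3, Pi.sub_apply, e1, e2]
  have h5 : ∀ᶠ k in atTop, (t k).crossNorm < N + ε :=
    h1.eventually_lt_const (by linarith)
  obtain ⟨k, hk⟩ := (h5.and (h3.eventually_lt_const hε)).exists
  exact ⟨t k, hk⟩

theorem HasMixedNorm.nonneg {m : ℕ} {n : Fin m → ℕ}
    {Ω : ∀ i, Set (EuclideanSpace ℝ (Fin (n i)))} {s : Fin m → ℝ}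
    {f : (∀ i, EuclideanSpace ℝ (Fin (n i))) → ℝ} {N : ℝ} (h : HasMixedNorm Ω s f N) : 0 ≤ N := by
  obtain ⟨t, -, h1, -⟩ := h
  exact ge_of_tendsto' h1 fun k => Real.sqrt_nonneg _

/-- The cross norm dominates the `L²` norm, and this survives the limit. It settles the case of
mixed norm `0`, where no relative approximation error is available. -/
theorem HasMixedNorm.norm_le {m : ℕ} {n : Fin m → ℕ}
    {Ω : ∀ i, Set (EuclideanSpace ℝ (Fin (n i)))} (hΩ : ∀ i, IsOpen (Ω i)) {s : Fin m → ℝ}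
    {F : Lp ℝ 2 (Measure.pi fun i => volume.restrict (Ω i))}
    {f : (∀ i, EuclideanSpace ℝ (Fin (n i))) → ℝ} {N : ℝ} (h : HasMixedNorm Ω s f N)
    (hF : F =ᵐ[Measure.pi fun i => volume.restrict (Ω i)] f) : ‖F‖ ≤ N := by
  refine le_of_forall_pos_le_add fun ε hε => ?_
  obtain ⟨t, h1, h2⟩ := h.exists_approx hF (half_pos hε)
  have h3 := norm_tensorImage_id_le hΩ t
  have h4 := norm_le_norm_add_norm_sub' F (tensorImage (fun _ => LinearMap.id) t)
  linarith

theorem mainTheorem1 {m : ℕ} (ℓ : ℕ) (hℓ : 1 ≤ ℓ) (hℓm : ℓ < m)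
    (n : Fin m → ℕ) (hn : ∀ i, 1 ≤ n i)
    (Ω : ∀ i, Set (EuclideanSpace ℝ (Fin (n i))))
    (hΩ_open : ∀ i, IsOpen (Ω i)) (hΩ_bdd : ∀ i, Bornology.IsBounded (Ω i))
    (r : Fin m → ℕ) (V : ∀ i, ℕ → Submodule ℝ (L2 (Ω i)))
    (hV : ∀ i, IsMultiscaleHierarchy (Ω i) (r i) (V i))
    (s : Fin m → ℝ) (hs : ∀ i, 0 ≤ s i) (hsr : ∀ i, s i ≤ r i)
    (β : ℝ)
    (hβ : β = (⨅ i : FirstIdx m ℓ, s i / n i) + ⨅ i : LastIdx m ℓ, s i / n i)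
    (P₁ P₂ : ℕ)
    (hP₁ : P₁ = minCount fun i : FirstIdx m ℓ => s i / n i)
    (hP₂ : P₂ = minCount fun i : LastIdx m ℓ => s i / n i) :
    ∃ C > (0 : ℝ), ∀ f : (∀ i, EuclideanSpace ℝ (Fin (n i))) → ℝ, MemMixedSobolev Ω s f →
      ∀ R : ℕ, 2 ≤ R →
        ∃ (g₁ : Fin R → (∀ i : FirstIdx m ℓ, EuclideanSpace ℝ (Fin (n i))) → ℝ)
          (g₂ : Fin R → (∀ i : LastIdx m ℓ, EuclideanSpace ℝ (Fin (n i))) → ℝ),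
          (∀ ρ, MemLp (g₁ ρ) 2 (Measure.pi fun i : FirstIdx m ℓ => volume.restrict (Ω i))) ∧
          (∀ ρ, MemLp (g₂ ρ) 2 (Measure.pi fun i : LastIdx m ℓ => volume.restrict (Ω i))) ∧
          MemLp (separableSum g₁ g₂) 2 (prodMeasure Ω) ∧
          eLpNorm (fun x => f x - separableSum g₁ g₂ x) 2 (prodMeasure Ω) ≤
            ENNReal.ofReal (C * (R : ℝ) ^ (-β) *
              Real.log R ^ (((m : ℝ) - 1) / 2 + β * (max (P₁ : ℝ) P₂ - 1)) *
              mixedSobolevNorm Ω s f) := by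
  obtain ⟨C, hC, happrox⟩ := exists_isSeparableSum_approx hℓ hℓm hn hΩ_open hV hs hsr hβ hP₁ hP₂
  refine ⟨4 * C, by positivity, fun f hf R hR => ?_⟩
  have hR0 : (0 : ℝ) < R := by positivity
  have hL0 : 0 < Real.log R := Real.log_pos (by exact_mod_cast hR)
  set γ : ℝ := ((m : ℝ) - 1) / 2 + β * (max (P₁ : ℝ) P₂ - 1)
  set rate : ℝ := C * (R : ℝ) ^ (-β) * Real.log R ^ γ with hrate
  have hrate0 : 0 < rate := by positivity
  obtain ⟨hfLp, hne⟩ := hf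
  set F : Lp ℝ 2 (Measure.pi fun i => volume.restrict (Ω i)) := hfLp.toLp f
  have hF : F =ᵐ[Measure.pi fun i => volume.restrict (Ω i)] f := hfLp.coeFn_toLp
  have hbdd : BddBelow {N | HasMixedNorm Ω s f N} := ⟨0, fun N hN => HasMixedNorm.nonneg hN⟩
  have hN0 : 0 ≤ mixedSobolevNorm Ω s f := Real.sInf_nonneg fun N hN => HasMixedNorm.nonneg hN
  suffices h : ∃ Z, IsSeparableSum
      (splitTensor (fun i => volume.restrict (Ω i)) (last_iff_not_first (ℓ := ℓ))) R Z ∧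
        ‖F - Z‖ ≤ 4 * rate * mixedSobolevNorm Ω s f by
    obtain ⟨Z, hZ, hFZ⟩ := h
    obtain ⟨g₁, g₂, hg₁, hg₂, hg⟩ := exists_functions_of_isSeparableSum hZ
    refine ⟨g₁, g₂, hg₁, hg₂, (memLp_congr_ae hg).1 (Lp.memLp Z), ?_⟩
    have e : eLpNorm (fun x => f x - separableSum g₁ g₂ x) 2 (prodMeasure Ω) =
        ENNReal.ofReal ‖F - Z‖ := by
      rw [ofReal_norm, Lp.enorm_def]
      refine eLpNorm_congr_ae ?_
      filter_upwards [hF, hg, Lp.coeFn_sub F Z] with x e1 e2 e3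
      rw [e3, Pi.sub_apply, e1, e2]
    rw [e]
    refine ENNReal.ofReal_le_ofReal (hFZ.trans_eq ?_)
    rw [hrate]
    ring
  rcases hN0.eq_or_lt with hzero | hpos
  · have hF0 : ‖F‖ ≤ mixedSobolevNorm Ω s f :=
      le_csInf hne fun N hN => HasMixedNorm.norm_le hΩ_open hN hF
    refine ⟨0, IsSeparableSum.zero R, ?_⟩
    rw [sub_zero, ← hzero, mul_zero]
    exact hF0.trans_eq hzero.symm
  -- No uniqueness of the norm value is needed: some admissible `N` is below `2 N₀`. With tolerance
  -- at most `N₀` the algebraic tensor has cross norm at most `3 N₀`, and with tolerance at most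
  -- `rate * N₀` the total is `(1 + 3) * rate * N₀`.
  · obtain ⟨N, hN, hN2⟩ := exists_lt_of_csInf_lt hne
      (show mixedSobolevNorm Ω s f < 2 * mixedSobolevNorm Ω s f by linarith)
    set N₀ := mixedSobolevNorm Ω s f
    obtain ⟨t, ht1, ht2⟩ := HasMixedNorm.exists_approx hN hF
      (lt_min hpos (mul_pos hrate0 hpos))
    obtain ⟨Z, hZ, hTZ⟩ := happrox t R hR
    refine ⟨Z, hZ, ?_⟩
    have h1 : t.crossNorm ≤ 3 * N₀ := by
      have := min_le_left N₀ (rate * N₀)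
      linarith
    have h2 : ‖F - tensorImage (fun _ => LinearMap.id) t‖ ≤ rate * N₀ :=
      ht2.le.trans (min_le_right _ _)
    have h3 := norm_sub_le_norm_sub_add_norm_sub F (tensorImage (fun _ => LinearMap.id) t) Z
    have h4 := mul_le_mul_of_nonneg_left h1 hrate0.le
    calc ‖F - Z‖ ≤ rate * N₀ + rate * (3 * N₀) := by linarith
      _ = 4 * rate * N₀ := by ring
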